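/- Let $d\ge 2$, let $\omega\subset\mathbb R^{d-1}$ be a bounded connected open set with Lipschitz boundary, and for $\varepsilon>0$ let $\Omega_\varepsilon=\omega\times(0,\varepsilon)\subset\mathbb R^d$. For $s\in(0,1)$ and a real-valued function $w$ on $\Omega_\varepsilon$ put $$[w]_s^2(\Omega_\varepsilon)=\int_{\Omega_\varepsilon\times\Omega_\varepsilon}\frac{|w(x)-w(y)|^2}{|x-y|^{d+2s}}\,dx\,dy\in[0,+\infty],$$ and let $H^s(\Omega_\varepsilon)$ be the set of $w\in L^2(\Omega_\varepsilon)$ with $[w]_s(\Omega_\varepsilon)<\infty$. Let $\varepsilon_j\to0^+$. Functions $w_j$ on $\Omega_{\varepsilon_j}$ are said to converge to $u:\omega\to\mathbb R$ in the sense of dimension reduction in $L^1_{\rm loc}$ if the functions $(x',t)\mapsto w_j(x',\varepsilon_j t)$ converge to $(x',t)\mapsto u(x')$ in $L^1_{\rm loc}(\omega\times(0,1))$. Let $s_\varepsilon\in(0,1)$ for $\varepsilon>0$, with $s_\varepsilon\to s_0\in(1/2,1)$ as $\varepsilon\to0^+$. Then for all $u\in H^1(\omega)$ $$\Gamma\text{-}\lim_{\varepsilon\to0}\frac1{\varepsilon^{3-2s_\varepsilon}}[\,\cdot\,]^2_{s_\varepsilon}(\Omega_\varepsilon)\,(u)=\frac1{1-s_0}\,K_{s_0,d}\int_\omega|\nabla'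 u|^2\,dx',\qquad K_{s,d}=\frac1{(3-2s)(d-1)}\int_{\mathbb R^{d-1}}\frac{|\xi'|^2}{(1+|\xi'|^2)^{\frac d2+s}}\,d\xi',$$ where the $\Gamma$-limit is computed with respect to dimension-reduction convergence in $L^1_{\rm loc}$, and the functionals may be considered on any domains $X_\varepsilon$ with $H^{s_\varepsilon}(\Omega_\varepsilon)\subseteq X_\varepsilon\subseteq L^1_{\rm loc}(\Omega_\varepsilon)$. That is, for every $u\in H^1(\omega)$ and every sequence of positive numbers $\varepsilon_j\to0$, with $s_j=s_{\varepsilon_j}$: 1. if $w_j\in X_{\varepsilon_j}$ converge to $u$ in the above sense, then $\displaystyle\liminf_{j\to\infty}\varepsilon_j^{-(3-2s_j)}[w_j]^2_{s_j}(\Omega_{\varepsilon_j})\ge\frac1{1-s_0}K_{s_0,d}\int_\omega|\nabla' u|^2\,dx'$; 2. there are $w_j\in X_{\varepsilon_j}$ that converge to $u$ in the above sense with $\displaystyle\limsup_{j\to\infty}\varepsilon_j^{-(3-2s_j)}[w_j]^2_{s_j}(\Omega_{\varepsilon_j})\le\frac1{1-s_0}K_{s_0,d}\int_\omega|\nabla'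 u|^2\,dx'$. -/

import Mathlib

open MeasureTheory Filter Topology Set
open scoped ENNReal

noncomputable section

namespace ThinFilm

/-- The planar space `ℝⁿ`, where `n = d - 1`. The ambient space `ℝ^d` is modelled as
`Plane n × ℝ` with its product Lebesgue measure; a point is `x = (x', x_d)`. -/
abbrev Plane (n : ℕ) : Type := EuclideanSpace ℝ (Fin n)

/-- The Euclidean distance of `ℝ^d = ℝⁿ × ℝ` (the built-in distance of a product type is the
maximum distance, which is not the one that is wanted here). -/
def eucDist {n : ℕ} (x y : Plane n × ℝ) : ℝ :=
  Real.sqrt (‖x.1 - y.1‖ ^ 2 + (x.2 - y.2) ^ 2)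

/-- The thin film `Ω_ε = ω × (0, ε)`. -/
def film {n : ℕ} (ω : Set (Plane n)) (ε : ℝ) : Set (Plane n × ℝ) := ω ×ˢ Ioo (0 : ℝ) ε

/-- The squared Gagliardo seminorm on `A ⊆ ℝ^d`, `d = n + 1`, with values in `[0, ∞]`:
the double integral over `A × A` of `|u x - u y|² / |x - y|^(d + 2s)`. -/
def gagliardoSq {n : ℕ} (s : ℝ) (A : Set (Plane n × ℝ)) (u : Plane n × ℝ → ℝ) : ℝ≥0∞ :=
  ∫⁻ p in A ×ˢ A,
    ENNReal.ofReal (|u p.1 - u p.2| ^ 2 / eucDist p.1 p.2 ^ (((n : ℝ) + 1) + 2 * s))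

/-- Membership in the fractional Sobolev space `H^s(A)`. -/
def MemHs {n : ℕ} (s : ℝ) (A : Set (Plane n × ℝ)) (u : Plane n × ℝ → ℝ) : Prop :=
  MemLp u 2 (volume.restrict A) ∧ gagliardoSq s A u < ∞

/-- The scaled energy `ε^{-(3-2s)} [u]²_s(Ω_ε)`. -/
def scaledEnergy {n : ℕ} (ω : Set (Plane n)) (s ε : ℝ) (u : Plane n × ℝ → ℝ) : ℝ≥0∞ :=
  ENNReal.ofReal (1 / ε ^ (3 - 2 * s)) * gagliardoSq s (film ω ε) u

/-- `ω` has Lipschitz boundary: near each boundary point there is a direction `ν` such that `ω` is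
the strict epigraph, in direction `ν`, of a Lipschitz function of the component orthogonal
to `ν`. -/
def HasLipschitzBoundary {n : ℕ} (ω : Set (Plane n)) : Prop :=
  ∀ p ∈ frontier ω, ∃ r : ℝ, 0 < r ∧ ∃ ν : Plane n, ‖ν‖ = 1 ∧
    ∃ (L : NNReal) (γ : Plane n → ℝ), LipschitzWith L γ ∧
      ω ∩ Metric.ball p r =
        {x | γ (x - (inner ℝ ν x) • ν) < inner ℝ ν x} ∩ Metric.ball p r

/-- `g` is a weak gradient of `u` in `ω`:
`∫_ω u ∂_v φ = - ∫_ω ⟨g, v⟩ φ` for all `φ ∈ C_c^∞(ω)` and all directions `v`. -/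
def IsWeakGradient {n : ℕ} (ω : Set (Plane n)) (u : Plane n → ℝ) (g : Plane n → Plane n) : Prop :=
  ∀ φ : Plane n → ℝ, ContDiff ℝ (⊤ : ℕ∞) φ → HasCompactSupport φ → tsupport φ ⊆ ω →
    ∀ v : Plane n,
      ∫ x in ω, u x * fderiv ℝ φ x v = - ∫ x in ω, inner ℝ (g x) v * φ x

/-- `u ∈ H¹(ω)` with weak gradient `g` (which is unique up to null sets). -/
def MemH1With {n : ℕ} (ω : Set (Plane n)) (u : Plane n → ℝ) (g : Plane n → Plane n) : Prop :=
  MemLp u 2 (volume.restrict ω) ∧ MemLp g 2 (volume.restrict ω) ∧ IsWeakGradient ω u g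

/-- Dimension-reduction convergence in `L¹_loc` of functions `w j` on `Ω_{e j}` to `u` on `ω`:
the rescaled functions `(x', t) ↦ w j (x', e j * t)` converge to `(x', t) ↦ u x'` in
`L¹_loc(ω × (0, 1))`, that is, in `L¹(K)` for each compact `K ⊆ ω × (0, 1)`. -/
def DRConvergesL1Loc {n : ℕ} (ω : Set (Plane n)) (e : ℕ → ℝ) (w : ℕ → Plane n × ℝ → ℝ)
    (u : Plane n → ℝ) : Prop :=
  ∀ K : Set (Plane n × ℝ), IsCompact K → K ⊆ film ω 1 →
    Tendsto (fun j => ∫⁻ x in K, ‖w j (x.1, e j * x.2) - u x.1‖ₑ) atTop (𝓝 0)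

/-- `value` is the `Γ`-limit at `u`, as `ε → 0⁺` and with respect to dimension-reduction
convergence in `L¹_loc`, of the functionals `F ε` with domains `X ε` (sets of functions on `Ω_ε`):
along every sequence of positive numbers tending to `0`, the lower bound and the existence of
a recovery sequence hold. -/
def IsDRGammaLimitAt {n : ℕ} (ω : Set (Plane n)) (X : ℝ → Set (Plane n × ℝ → ℝ))
    (F : ℝ → (Plane n × ℝ → ℝ) → ℝ≥0∞) (u : Plane n → ℝ) (value : ℝ≥0∞) : Prop :=
  ∀ e : ℕ → ℝ, (∀ j, 0 < e j) → Tendsto e atTop (𝓝 0) →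
    (∀ w : ℕ → Plane n × ℝ → ℝ, (∀ j, w j ∈ X (e j)) → DRConvergesL1Loc ω e w u →
      value ≤ liminf (fun j => F (e j) (w j)) atTop) ∧
    (∃ w : ℕ → Plane n × ℝ → ℝ, (∀ j, w j ∈ X (e j)) ∧ DRConvergesL1Loc ω e w u ∧
      limsup (fun j => F (e j) (w j)) atTop ≤ value)

/-- The constant `K_{s,d}` with `d = n + 1`. -/
def Kconst (n : ℕ) (s : ℝ) : ℝ :=
  1 / ((3 - 2 * s) * n) *
    ∫ ξ : Plane n, ‖ξ‖ ^ 2 / (1 + ‖ξ‖ ^ 2) ^ (((n : ℝ) + 1) / 2 + s)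

/-- The integral that defines `K_{s,d}` converges for `s > 1/2`. -/
theorem integrable_Kconst (n : ℕ) {s : ℝ} (hs : 1 / 2 < s) :
    Integrable (fun ξ : Plane n => ‖ξ‖ ^ 2 / (1 + ‖ξ‖ ^ 2) ^ (((n : ℝ) + 1) / 2 + s)) := by
  have h := integrable_rpow_neg_one_add_norm_sq (E := Plane n) (μ := volume)
    (r := (n : ℝ) + 2 * s - 1) (by simp; linarith)
  have hm : Measurable
      (fun ξ : Plane n => ‖ξ‖ ^ 2 / (1 + ‖ξ‖ ^ 2) ^ (((n : ℝ) + 1) / 2 + s)) := by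
    measurability
  refine h.mono' hm.aestronglyMeasurable (Eventually.of_forall fun ξ => ?_)
  have h1 : (0 : ℝ) < 1 + ‖ξ‖ ^ 2 := by positivity
  rw [Real.norm_of_nonneg (by positivity), div_le_iff₀ (by positivity), ← Real.rpow_add h1]
  have h2 : -((n : ℝ) + 2 * s - 1) / 2 + (((n : ℝ) + 1) / 2 + s) = 1 := by ring
  rw [h2, Real.rpow_one]
  linarith

end ThinFilm

end

noncomputable section

namespace ThinFilm

open scoped Convolution Manifold

/-! Substituting `x_d = ε t`, `y_d = ε τ`, `y' = x' + ε |t - τ| ξ` turns the distance into `ε |t -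
τ| (1 + |ξ|²)^{1/2}`. No power of `ε` survives: the scaled energy is the integral of the weight `|t
- τ|^{1-2s}` times the radial kernel `(1 + |ξ|²)^{-(d/2+s)}` times squared difference quotients with
step `h = ε |t - τ|` in direction `ξ` (`scaledEnergy_eq_blowup`). As `h → 0` these quotients should
tend to `⟨∇u, ξ⟩`. The weight has integral `1/((1-s)(3-2s))` over `(0,1)²`, and isotropy of the
kernel turns `⟨∇u, ξ⟩²` into a multiple of `|∇u|²`; the product is the claimed constant.

Lower bound. The quotient `(w(x + hξ, ετ) - w(x, εt)) / h` mixes two heights, and `L¹` convergence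
controls no rate. Combining `ξ` with `-ξ` by convexity removes the value at height `t` and leaves a
symmetric quotient `q` at the single height `τ` (`lintegral_symBlowup_le`). Now `q² ≥ 2qψ - ψ²`, and
discrete integration by parts moves the quotient onto the smooth `ψ`, so `L¹` convergence of the
slice suffices (`le_liminf_lintegral_symQuot_sq`). Taking `ψ = ⟨Φ, ξ⟩` and applying Fatou in `(t, τ,
ξ)` gives the bound up to a multiple of `‖g - Φ‖²` (`le_liminf_scaledEnergy_add`), which density of
smooth fields makes small. Slices converge only for almost every `τ` in compact height intervals and
along subsequences; `heightWeight_mul_le_liminf` deals with this.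

Upper bound. For a compactly supported `C¹` function of `x'` alone, dominated convergence computes
the limit (`limsup_scaledEnergy_le`). Such functions are dense in `H¹(ω)` because the Lipschitz
boundary lets `ω` be pushed into itself before mollifying (`MemH1With.h1Approx`); a diagonal choice
then yields a recovery sequence. -/

/-! ### The kernel and its second moments -/

/-- The radial kernel of the blown-up Gagliardo energy. -/
def kern (n : ℕ) (s : ℝ) (ξ : Plane n) : ℝ := ((1 + ‖ξ‖ ^ 2) ^ (((n : ℝ) + 1) / 2 + s))⁻¹

theorem kern_pos (n : ℕ) (s : ℝ) (ξ : Plane n) : 0 < kern n s ξ := by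
  unfold kern; positivity

@[fun_prop]
theorem measurable_kern (n : ℕ) (s : ℝ) : Measurable (kern n s) := by
  unfold kern; fun_prop

theorem kern_neg (n : ℕ) (s : ℝ) (ξ : Plane n) : kern n s (-ξ) = kern n s ξ := by
  simp [kern]

theorem kern_anti (n : ℕ) {s s' : ℝ} (h : s ≤ s') (ξ : Plane n) : kern n s' ξ ≤ kern n s ξ := by
  unfold kern
  have h1 : (1 : ℝ) ≤ 1 + ‖ξ‖ ^ 2 := by nlinarith [sq_nonneg ‖ξ‖]
  gcongr

theorem integrable_kern_mul_norm_sq (n : ℕ) {s : ℝ} (hs : 1 / 2 < s) :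
    Integrable fun ξ : Plane n => kern n s ξ * ‖ξ‖ ^ 2 := by
  refine (integrable_Kconst n hs).congr (Eventually.of_forall fun ξ => ?_)
  simp only [kern]
  rw [div_eq_inv_mul]

theorem integrable_kern_mul_inner_sq (n : ℕ) {s : ℝ} (hs : 1 / 2 < s) (a : Plane n) :
    Integrable fun ξ : Plane n => kern n s ξ * inner ℝ a ξ ^ 2 := by
  refine ((integrable_kern_mul_norm_sq n hs).const_mul (‖a‖ ^ 2)).mono' (by fun_prop)
    (Eventually.of_forall fun ξ => ?_)
  have hk := kern_pos n s ξ
  rw [Real.norm_of_nonneg (by positivity)]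
  have : inner ℝ a ξ ^ 2 ≤ (‖a‖ * ‖ξ‖) ^ 2 :=
    sq_le_sq.2 ((abs_real_inner_le_norm a ξ).trans (le_abs_self _))
  calc kern n s ξ * inner ℝ a ξ ^ 2 ≤ kern n s ξ * (‖a‖ * ‖ξ‖) ^ 2 := by gcongr
    _ = _ := by ring

/-- The reflection exchanging two vectors of equal norm preserves both Lebesgue measure and the
radial kernel. -/
theorem integral_kern_mul_inner_sq_of_norm_eq (n : ℕ) (s : ℝ) {a b : Plane n} (h : ‖a‖ = ‖b‖) :
    ∫ ξ, kern n s ξ * inner ℝ a ξ ^ 2 = ∫ ξ, kern n s ξ * inner ℝ b ξ ^ 2 := by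
  set R := (Submodule.span ℝ {a - b})ᗮ.reflection
  have hR : R a = b := Submodule.reflection_sub h
  rw [← R.measurePreserving.integral_comp' (f := R.toHomeomorph.toMeasurableEquiv)
    (fun ξ => kern n s ξ * inner ℝ b ξ ^ 2)]
  refine integral_congr_ae (Eventually.of_forall fun ξ => ?_)
  have h2 : inner ℝ b (R ξ) = inner ℝ a ξ := by rw [← hR, R.inner_map_map]
  simp only [kern, Homeomorph.toMeasurableEquiv_coe, LinearIsometryEquiv.coe_toHomeomorph,
    R.norm_map, h2]

/-- The second moments of a radial kernel are isotropic. -/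
theorem integral_kern_mul_inner_sq {n : ℕ} (hn : 1 ≤ n) {s : ℝ} (hs : 1 / 2 < s) (a : Plane n) :
    ∫ ξ, kern n s ξ * inner ℝ a ξ ^ 2 = 1 / n * (∫ ξ : Plane n, kern n s ξ * ‖ξ‖ ^ 2) * ‖a‖ ^ 2 := by
  have hn0 : (n : ℝ) ≠ 0 := by positivity
  -- The vector `a` may be moved onto each coordinate axis without changing the integral; summing
  -- over the `n` axes recovers `‖ξ‖²`.
  have key : ∀ i : Fin n, ∫ ξ, kern n s ξ * inner ℝ a ξ ^ 2 =
      ‖a‖ ^ 2 * ∫ ξ : Plane n, kern n s ξ * ξ i ^ 2 := by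
    intro i
    rw [integral_kern_mul_inner_sq_of_norm_eq n s (b := EuclideanSpace.single i ‖a‖) (by simp),
      ← integral_const_mul]
    congr 1 with ξ
    simp only [EuclideanSpace.inner_single_left, conj_trivial]
    ring
  have hsum : ∫ ξ : Plane n, kern n s ξ * ‖ξ‖ ^ 2 = ∑ i, ∫ ξ : Plane n, kern n s ξ * ξ i ^ 2 := by
    rw [← integral_finsetSum]
    · congr 1 with ξ
      rw [EuclideanSpace.real_norm_sq_eq, Finset.mul_sum]
    · intro i _
      have := integrable_kern_mul_inner_sq n hs (EuclideanSpace.single i (1 : ℝ))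
      simpa only [EuclideanSpace.inner_single_left, conj_trivial, one_mul] using this
  have : (n : ℝ) * ∫ ξ, kern n s ξ * inner ℝ a ξ ^ 2 =
      ‖a‖ ^ 2 * ∫ ξ : Plane n, kern n s ξ * ‖ξ‖ ^ 2 := by
    rw [hsum, Finset.mul_sum, ← Finset.sum_congr rfl (fun i _ => key i)]
    simp
  field_simp
  linarith

/-- The second moment `(1 / n) ∫ k_s |ξ|²` of the kernel. -/
def kernMoment (n : ℕ) (s : ℝ) : ℝ := 1 / n * ∫ ξ : Plane n, kern n s ξ * ‖ξ‖ ^ 2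

theorem kernMoment_nonneg (n : ℕ) (s : ℝ) : 0 ≤ kernMoment n s := by
  unfold kernMoment
  have : 0 ≤ ∫ ξ : Plane n, kern n s ξ * ‖ξ‖ ^ 2 :=
    integral_nonneg fun ξ => mul_nonneg (kern_pos n s ξ).le (by positivity)
  positivity

theorem Kconst_eq (n : ℕ) (s : ℝ) : Kconst n s = 1 / (3 - 2 * s) * kernMoment n s := by
  have : ∀ ξ : Plane n, ‖ξ‖ ^ 2 / (1 + ‖ξ‖ ^ 2) ^ (((n : ℝ) + 1) / 2 + s) =
      kern n s ξ * ‖ξ‖ ^ 2 := fun ξ => by rw [kern, div_eq_inv_mul]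
  simp only [Kconst, kernMoment, this]
  rw [← mul_assoc, one_div_mul_one_div]

theorem lintegral_kern_mul_inner_sq {n : ℕ} (hn : 1 ≤ n) {s : ℝ} (hs : 1 / 2 < s) (a : Plane n) :
    ∫⁻ ξ, ENNReal.ofReal (kern n s ξ * inner ℝ a ξ ^ 2) =
      ENNReal.ofReal (kernMoment n s) * ENNReal.ofReal (‖a‖ ^ 2) := by
  rw [← ENNReal.ofReal_mul (kernMoment_nonneg n s), kernMoment,
    ← integral_kern_mul_inner_sq hn hs, ofReal_integral_eq_lintegral_ofReal
      (integrable_kern_mul_inner_sq n hs a)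
      (Eventually.of_forall fun ξ => mul_nonneg (kern_pos n s ξ).le (sq_nonneg _))]

/-- Tonelli form of the isotropy of the kernel. -/
theorem lintegral_kern_mul_lintegral_inner_sq {n : ℕ} (hn : 1 ≤ n) {s : ℝ} (hs : 1 / 2 < s)
    {μ : Measure (Plane n)} [SFinite μ] {f : Plane n → Plane n} (hf : AEMeasurable f μ) :
    ∫⁻ ξ, ENNReal.ofReal (kern n s ξ) * ∫⁻ x, ENNReal.ofReal (inner ℝ (f x) ξ ^ 2) ∂μ =
      ENNReal.ofReal (kernMoment n s) * ∫⁻ x, ENNReal.ofReal (‖f x‖ ^ 2) ∂μ := by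
  rw [← lintegral_const_mul'' _ (by fun_prop)]
  simp_rw [← lintegral_kern_mul_inner_sq hn hs]
  rw [lintegral_lintegral_swap]
  · refine lintegral_congr fun ξ => ?_
    rw [← lintegral_const_mul' _ _ ENNReal.ofReal_ne_top]
    refine lintegral_congr fun x => ?_
    rw [ENNReal.ofReal_mul (kern_pos n s ξ).le]
  · have : AEMeasurable (fun p : Plane n × Plane n => f p.1) (μ.prod volume) :=
      hf.comp_quasiMeasurePreserving Measure.quasiMeasurePreserving_fst
    unfold Function.uncurry
    fun_prop

/-! ### The weight in the heights -/

/-- Splitting at `τ = t` leaves two one-sided power integrals; `r > -1` makes the singularity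
integrable. It is used with `r = 1 - 2s`, so the condition is `s < 1`. -/
theorem integral_abs_sub_rpow {r : ℝ} (hr : -1 < r) {t : ℝ} (ht : t ∈ Icc (0 : ℝ) 1) :
    IntervalIntegrable (fun τ => |t - τ| ^ r) volume 0 1 ∧
    ∫ τ in (0 : ℝ)..1, |t - τ| ^ r = (t ^ (r + 1) + (1 - t) ^ (r + 1)) / (r + 1) := by
  have hr1 : r + 1 ≠ 0 := by linarith
  have i1 : IntervalIntegrable (fun τ => (t - τ) ^ r) volume 0 t := by
    have := (intervalIntegral.intervalIntegrable_rpow' hr (a := t) (b := 0)).comp_sub_left t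
    simpa using this
  have i2 : IntervalIntegrable (fun τ => (τ - t) ^ r) volume t 1 := by
    have := (intervalIntegral.intervalIntegrable_rpow' hr (a := 0) (b := 1 - t)).comp_sub_right t
    simpa using this
  have e1 : EqOn (fun τ => (t - τ) ^ r) (fun τ => |t - τ| ^ r) (uIcc 0 t) := by
    intro τ hτ
    rw [uIcc_of_le ht.1] at hτ
    simp only [abs_of_nonneg (sub_nonneg.2 hτ.2)]
  have e2 : EqOn (fun τ => (τ - t) ^ r) (fun τ => |t - τ| ^ r) (uIcc t 1) := by
    intro τ hτ
    rw [uIcc_of_le ht.2] at hτ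
    simp only [abs_sub_comm t τ, abs_of_nonneg (sub_nonneg.2 hτ.1)]
  have j1 := i1.congr (e1.mono uIoc_subset_uIcc)
  have j2 := i2.congr (e2.mono uIoc_subset_uIcc)
  refine ⟨j1.trans j2, ?_⟩
  rw [← intervalIntegral.integral_add_adjacent_intervals j1 j2,
    ← intervalIntegral.integral_congr e1, ← intervalIntegral.integral_congr e2,
    intervalIntegral.integral_comp_sub_left (fun x => x ^ r),
    intervalIntegral.integral_comp_sub_right (fun x => x ^ r),
    integral_rpow (Or.inl hr), integral_rpow (Or.inl hr)]
  simp [Real.zero_rpow hr1]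
  ring

theorem lintegral_abs_sub_rpow {r : ℝ} (hr : -1 < r) :
    ∫⁻ t in Ioo (0 : ℝ) 1, ∫⁻ τ in Ioo (0 : ℝ) 1, ENNReal.ofReal (|t - τ| ^ r) =
      ENNReal.ofReal (2 / ((r + 1) * (r + 2))) := by
  have hr1 : 0 < r + 1 := by linarith
  have inner : ∀ t ∈ Ioo (0 : ℝ) 1, ∫⁻ τ in Ioo (0 : ℝ) 1, ENNReal.ofReal (|t - τ| ^ r) =
      ENNReal.ofReal ((t ^ (r + 1) + (1 - t) ^ (r + 1)) / (r + 1)) := by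
    intro t ht
    obtain ⟨h1, h2⟩ := integral_abs_sub_rpow hr (Ioo_subset_Icc_self ht)
    rw [← h2, intervalIntegral.integral_of_le zero_le_one, integral_Ioc_eq_integral_Ioo,
      ofReal_integral_eq_lintegral_ofReal]
    · exact ((intervalIntegrable_iff_integrableOn_Ioc_of_le zero_le_one).1 h1).mono_set
        Ioo_subset_Ioc_self
    · exact Eventually.of_forall fun τ => by positivity
  rw [setLIntegral_congr_fun measurableSet_Ioo inner]
  have i1 : IntervalIntegrable (fun t : ℝ => t ^ (r + 1)) volume 0 1 :=
    intervalIntegral.intervalIntegrable_rpow' (by linarith)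
  have i2 : IntervalIntegrable (fun t : ℝ => (1 - t) ^ (r + 1)) volume 0 1 := by
    have := (intervalIntegral.intervalIntegrable_rpow' (r := r + 1) (by linarith)
      (a := 1) (b := 0)).comp_sub_left 1
    simpa using this
  have i3 := (i1.add i2).div_const (r + 1)
  have : ∫ t in (0 : ℝ)..1, (t ^ (r + 1) + (1 - t) ^ (r + 1)) / (r + 1) =
      2 / ((r + 1) * (r + 2)) := by
    rw [intervalIntegral.integral_div, intervalIntegral.integral_add i1 i2,
      intervalIntegral.integral_comp_sub_left (fun x => x ^ (r + 1)),
      sub_self, sub_zero, integral_rpow (Or.inl (by linarith))]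
    have : r + 1 + 1 ≠ 0 := by linarith
    have h2 : r + 2 ≠ 0 := by linarith
    rw [Real.zero_rpow this, Real.one_rpow]
    field_simp
    ring
  rw [← this, intervalIntegral.integral_of_le zero_le_one, integral_Ioc_eq_integral_Ioo,
      ofReal_integral_eq_lintegral_ofReal]
  · exact ((intervalIntegrable_iff_integrableOn_Ioc_of_le zero_le_one).1 i3).mono_set
        Ioo_subset_Ioc_self
  · refine (ae_restrict_iff' measurableSet_Ioo).2 (Eventually.of_forall fun t ht => ?_)
    have := ht.1.le
    have := sub_nonneg.2 ht.2.le
    simp only [Pi.zero_apply]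
    positivity

/-! ### The energy in blown-up variables -/

theorem lintegral_eq_lintegral_add_smul {n : ℕ} {h : ℝ} (hh : 0 < h) (x : Plane n)
    (f : Plane n → ℝ≥0∞) :
    ∫⁻ y, f y = ENNReal.ofReal (h ^ n) * ∫⁻ ξ, f (x + h • ξ) := by
  have h1 := Measure.map_addHaar_smul (volume : Measure (Plane n)) hh.ne'
  have h2 := lintegral_map_equiv (μ := volume) (fun y => f (x + y))
    (MeasurableEquiv.smul₀ h hh.ne' : Plane n ≃ᵐ Plane n)
  simp only [MeasurableEquiv.coe_smul₀, h1, lintegral_smul_measure, finrank_euclideanSpace,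
    Fintype.card_fin, smul_eq_mul] at h2
  rw [← h2, ← mul_assoc, ← ENNReal.ofReal_mul (by positivity), abs_of_pos (by positivity),
    mul_inv_cancel₀ (by positivity), ENNReal.ofReal_one, one_mul, lintegral_add_left_eq_self]

theorem setLIntegral_Ioo_eq_smul {ε : ℝ} (hε : 0 < ε) (f : ℝ → ℝ≥0∞) :
    ∫⁻ t in Ioo 0 ε, f t = ENNReal.ofReal ε * ∫⁻ t in Ioo (0 : ℝ) 1, f (ε * t) := by
  have h1 : ∀ g : ℝ → ℝ≥0∞, ∫⁻ t, g t = ENNReal.ofReal ε * ∫⁻ t, g (ε * t) := by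
    intro g
    have h2 := lintegral_map_equiv (μ := volume) g (MeasurableEquiv.mulLeft₀ ε hε.ne')
    rw [MeasurableEquiv.coe_mulLeft₀] at h2
    rw [← h2]
    nth_rw 1 [← Real.smul_map_volume_mul_left hε.ne']
    rw [lintegral_smul_measure, abs_of_pos hε, smul_eq_mul]
  rw [← lintegral_indicator measurableSet_Ioo, h1, ← lintegral_indicator measurableSet_Ioo]
  congr 2 with t
  have : ε * t ∈ Ioo 0 ε ↔ t ∈ Ioo (0 : ℝ) 1 := by
    simp only [mem_Ioo, mul_pos_iff_of_pos_left hε, mul_lt_iff_lt_one_right hε]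
  by_cases ht : t ∈ Ioo (0 : ℝ) 1
  · rw [indicator_of_mem ht, indicator_of_mem (this.2 ht)]
  · rw [indicator_of_notMem ht, indicator_of_notMem (mt this.1 ht)]

/-- The set of points `x` for which both `x` and `x + h ξ` lie in `ω`. -/
def pairSet {n : ℕ} (ω : Set (Plane n)) (v : Plane n) : Set (Plane n) :=
  {x | x ∈ ω ∧ x + v ∈ ω}

/-- The integrand of the energy in blown-up variables. -/
def blowup {n : ℕ} (s ε : ℝ) (w : Plane n × ℝ → ℝ) (t τ : ℝ) (ξ x : Plane n) : ℝ≥0∞ :=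
  ENNReal.ofReal (|t - τ| ^ (1 - 2 * s) * kern n s ξ *
    ((w (x + (ε * |t - τ|) • ξ, ε * τ) - w (x, ε * t)) / (ε * |t - τ|)) ^ 2)

theorem measurable_eucDist {n : ℕ} :
    Measurable fun p : (Plane n × ℝ) × (Plane n × ℝ) => eucDist p.1 p.2 := by
  unfold eucDist; fun_prop

/-- Power count with `h = ε |t - τ|`: the Jacobians give `ε² hⁿ`, the kernel `h^{-(n+1+2s)}`, and
dividing the difference by `h` costs `h²`. This leaves `ε² h^{1-2s}`, whose power of `ε` is exactly
`3 - 2s`. -/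
theorem gagliardo_integrand_eq_blowup {n : ℕ} {s ε : ℝ} (hε : 0 < ε) (w : Plane n × ℝ → ℝ)
    {t τ : ℝ} (h : t ≠ τ) (ξ x : Plane n) :
    ENNReal.ofReal (1 / ε ^ (3 - 2 * s)) * (ENNReal.ofReal ε * (ENNReal.ofReal ε *
      (ENNReal.ofReal ((ε * |t - τ|) ^ n) *
        ENNReal.ofReal (|w (x, ε * t) - w (x + (ε * |t - τ|) • ξ, ε * τ)| ^ 2 /
          eucDist (x, ε * t) (x + (ε * |t - τ|) • ξ, ε * τ) ^ (((n : ℝ) + 1) + 2 * s))))) =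
      blowup s ε w t τ ξ x := by
  have hd : 0 < |t - τ| := abs_pos.2 (sub_ne_zero.2 h)
  have hh : 0 < ε * |t - τ| := by positivity
  have h1 : (0 : ℝ) < 1 + ‖ξ‖ ^ 2 := by positivity
  have heuc : eucDist (x, ε * t) (x + (ε * |t - τ|) • ξ, ε * τ) =
      (ε * |t - τ|) * (1 + ‖ξ‖ ^ 2) ^ (1 / 2 : ℝ) := by
    rw [← Real.sqrt_eq_rpow, eucDist]
    have : ‖x - (x + (ε * |t - τ|) • ξ)‖ ^ 2 + (ε * t - ε * τ) ^ 2 =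
        (ε * |t - τ|) ^ 2 * (1 + ‖ξ‖ ^ 2) := by
      have : x - (x + (ε * |t - τ|) • ξ) = -((ε * |t - τ|) • ξ) := by abel
      rw [this, norm_neg, norm_smul, Real.norm_of_nonneg hh.le, ← mul_sub, mul_pow ε, mul_pow ε,
        sq_abs, mul_pow, mul_pow ε, sq_abs]
      ring
    simp only [this]
    rw [Real.sqrt_mul (by positivity), Real.sqrt_sq hh.le]
  rw [heuc, Real.mul_rpow hh.le (by positivity), ← Real.rpow_mul h1.le]
  have e1 : (1 / 2 : ℝ) * (((n : ℝ) + 1) + 2 * s) = ((n : ℝ) + 1) / 2 + s := by ring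
  rw [e1, blowup, ← ENNReal.ofReal_mul (by positivity), ← ENNReal.ofReal_mul (by positivity),
    ← ENNReal.ofReal_mul (by positivity), ← ENNReal.ofReal_mul (by positivity), sq_abs]
  congr 1
  rw [kern]
  have e2 : (ε * |t - τ|) ^ (((n : ℝ) + 1) + 2 * s) =
      (ε * |t - τ|) ^ n * ε ^ 2 * |t - τ| ^ 2 * (ε ^ (2 * s - 1) * |t - τ| ^ (2 * s - 1)) := by
    rw [← Real.mul_rpow hε.le hd.le, mul_assoc _ (ε ^ 2), ← mul_pow, ← Real.rpow_natCast _ n,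
      ← Real.rpow_natCast _ 2, ← Real.rpow_add hh, ← Real.rpow_add hh]
    congr 1; push_cast; ring
  have e3 : ε ^ (3 - 2 * s) = ε ^ 2 * (ε ^ (2 * s - 1))⁻¹ := by
    rw [← Real.rpow_neg hε.le, ← Real.rpow_natCast _ 2, ← Real.rpow_add hε]
    congr 1; push_cast; ring
  have e4 : |t - τ| ^ (1 - 2 * s) = (|t - τ| ^ (2 * s - 1))⁻¹ := by
    rw [← Real.rpow_neg hd.le]; congr 1; ring
  rw [e2, e3, e4]
  have p1 : 0 < ε ^ (2 * s - 1) := by positivity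
  have p2 : 0 < |t - τ| ^ (2 * s - 1) := by positivity
  have p3 : 0 < (1 + ‖ξ‖ ^ 2) ^ (((n : ℝ) + 1) / 2 + s) := by positivity
  field_simp
  ring

theorem measurable_blowup {n : ℕ} (s ε : ℝ) {w : Plane n × ℝ → ℝ} (hw : Measurable w) :
    Measurable fun p : (ℝ × ℝ) × (Plane n × Plane n) => blowup s ε w p.1.1 p.1.2 p.2.1 p.2.2 := by
  unfold blowup; fun_prop

theorem measurableSet_pairSet {n : ℕ} {ω : Set (Plane n)} (hω : MeasurableSet ω) (v : Plane n) :
    MeasurableSet (pairSet ω v) :=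
  hω.inter (measurable_add_const v hω)

/-- The scaled energy in the blown-up variables `x_d = ε t`, `y_d = ε τ`,
`y' = x' + ε |t - τ| ξ`. -/
theorem scaledEnergy_eq_blowup {n : ℕ} {ω : Set (Plane n)} (hω : MeasurableSet ω) {s ε : ℝ}
    (hε : 0 < ε) {w : Plane n × ℝ → ℝ} (hw : Measurable w) :
    scaledEnergy ω s ε w = ∫⁻ t in Ioo (0 : ℝ) 1, ∫⁻ τ in Ioo (0 : ℝ) 1, ∫⁻ ξ,
      ∫⁻ x in pairSet ω ((ε * |t - τ|) • ξ), blowup s ε w t τ ξ x := by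
  set F : (Plane n × ℝ) × (Plane n × ℝ) → ℝ≥0∞ := fun p =>
    ENNReal.ofReal (|w p.1 - w p.2| ^ 2 / eucDist p.1 p.2 ^ (((n : ℝ) + 1) + 2 * s)) with hF
  have hFm : Measurable F := by
    have := @measurable_eucDist n
    fun_prop
  -- Tonelli puts the heights outermost, since the planar substitution depends on both of them.
  have step1 : gagliardoSq s (film ω ε) w =
      ∫⁻ t in Ioo 0 ε, ∫⁻ τ in Ioo 0 ε, ∫⁻ x in ω, ∫⁻ y in ω, F ((x, t), (y, τ)) := by
    unfold gagliardoSq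
    rw [Measure.volume_eq_prod, setLIntegral_prod _ hFm.aemeasurable, film,
      Measure.volume_eq_prod, setLIntegral_prod_symm _ (by fun_prop)]
    refine lintegral_congr fun t => ?_
    rw [lintegral_lintegral_swap (by unfold Function.uncurry; fun_prop),
      setLIntegral_prod_symm]
    · refine lintegral_congr fun τ => ?_
      rw [lintegral_lintegral_swap (by unfold Function.uncurry; fun_prop)]
    · have : Measurable fun p : (Plane n × ℝ) × Plane n => F ((p.2, t), p.1) := by fun_prop
      exact (this.lintegral_prod_right' (ν := volume.restrict ω)).aemeasurable
  rw [scaledEnergy, step1, setLIntegral_Ioo_eq_smul hε]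
  simp_rw [setLIntegral_Ioo_eq_smul hε]
  have step2 : ∀ t τ : ℝ, t ≠ τ → ∫⁻ x in ω, ∫⁻ y in ω, F ((x, ε * t), (y, ε * τ)) =
      ENNReal.ofReal ((ε * |t - τ|) ^ n) * ∫⁻ ξ, ∫⁻ x in pairSet ω ((ε * |t - τ|) • ξ),
        F ((x, ε * t), (x + (ε * |t - τ|) • ξ, ε * τ)) := by
    intro t τ htτ
    have hh : 0 < ε * |t - τ| := mul_pos hε (abs_pos.2 (sub_ne_zero.2 htτ))
    set h := ε * |t - τ|
    have e1 : ∀ x ∈ ω, ∫⁻ y in ω, F ((x, ε * t), (y, ε * τ)) = ENNReal.ofReal (h ^ n) *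
        ∫⁻ ξ, ω.indicator (fun y => F ((x, ε * t), (y, ε * τ))) (x + h • ξ) := fun x _ => by
      rw [← lintegral_indicator hω, lintegral_eq_lintegral_add_smul hh x]
    rw [setLIntegral_congr_fun hω e1, lintegral_const_mul' _ _ ENNReal.ofReal_ne_top,
      lintegral_lintegral_swap]
    · congr 1
      refine lintegral_congr fun ξ => ?_
      have : pairSet ω (h • ξ) = ((fun x => x + h • ξ) ⁻¹' ω) ∩ ω := by
        ext x; simp [pairSet, and_comm]
      rw [this, ← setLIntegral_indicator (measurable_add_const _ hω)]
      rfl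
    · have : Measurable fun p : Plane n × Plane n =>
          (((fun q : Plane n × Plane n => q.1 + h • q.2) ⁻¹' ω).indicator
            fun q => F ((q.1, ε * t), (q.1 + h • q.2, ε * τ))) p :=
        (by fun_prop : Measurable fun q : Plane n × Plane n =>
          F ((q.1, ε * t), (q.1 + h • q.2, ε * τ))).indicator
          ((by fun_prop : Measurable fun q : Plane n × Plane n => q.1 + h • q.2) hω)
      exact this.aemeasurable
  rw [← lintegral_const_mul' _ _ ENNReal.ofReal_ne_top,
    ← lintegral_const_mul' _ _ ENNReal.ofReal_ne_top]
  refine lintegral_congr fun t => ?_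
  rw [← lintegral_const_mul' _ _ ENNReal.ofReal_ne_top,
    ← lintegral_const_mul' _ _ ENNReal.ofReal_ne_top,
    ← lintegral_const_mul' _ _ ENNReal.ofReal_ne_top]
  refine lintegral_congr_ae ?_
  -- On the diagonal the planar substitution degenerates, but for fixed `t` it is a single point.
  have hne : ∀ᵐ τ ∂(volume.restrict (Ioo (0 : ℝ) 1)), t ≠ τ := by
    filter_upwards [ae_restrict_of_ae (Measure.ae_ne volume t)] with τ h using h.symm
  filter_upwards [hne] with τ hτ
  rw [step2 t τ hτ]
  simp_rw [← lintegral_const_mul' _ _ ENNReal.ofReal_ne_top]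
  refine lintegral_congr fun ξ => lintegral_congr fun x => ?_
  exact gagliardo_integrand_eq_blowup hε w hτ ξ x

/-! ### Symmetrisation in the direction -/

/-- The set of points `x` for which `x` and `x ± v` lie in `ω`. -/
def tripleSet {n : ℕ} (ω : Set (Plane n)) (v : Plane n) : Set (Plane n) :=
  pairSet ω v ∩ pairSet ω (-v)

/-- The integrand of the symmetrised energy. -/
def symBlowup {n : ℕ} (s ε : ℝ) (w : Plane n × ℝ → ℝ) (t τ : ℝ) (ξ x : Plane n) : ℝ≥0∞ :=
  ENNReal.ofReal (|t - τ| ^ (1 - 2 * s) * kern n s ξ *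
    ((w (x + (ε * |t - τ|) • ξ, ε * τ) - w (x - (ε * |t - τ|) • ξ, ε * τ)) /
      (2 * (ε * |t - τ|))) ^ 2)

theorem measurable_symBlowup {n : ℕ} (s ε : ℝ) {w : Plane n × ℝ → ℝ} (hw : Measurable w) :
    Measurable fun p : (ℝ × ℝ) × (Plane n × Plane n) =>
      symBlowup s ε w p.1.1 p.1.2 p.2.1 p.2.2 := by
  unfold symBlowup; fun_prop

theorem measurable_lintegral_symBlowup {n : ℕ} {ω : Set (Plane n)} (hω : MeasurableSet ω)
    (s ε : ℝ) {w : Plane n × ℝ → ℝ} (hw : Measurable w) :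
    Measurable fun p : (ℝ × ℝ) × Plane n =>
      ∫⁻ x in tripleSet ω ((ε * |p.1.1 - p.1.2|) • p.2), symBlowup s ε w p.1.1 p.1.2 p.2 x := by
  -- The domain of the inner integral varies with the parameters, so measurability is proved for an
  -- indicator on the full product.
  have hS : MeasurableSet {q : ((ℝ × ℝ) × Plane n) × Plane n |
      q.2 ∈ tripleSet ω ((ε * |q.1.1.1 - q.1.1.2|) • q.1.2)} := by
    refine .inter (.inter (measurable_snd hω) ?_) (.inter (measurable_snd hω) ?_)
    · exact (by fun_prop : Measurable fun q : ((ℝ × ℝ) × Plane n) × Plane n =>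
        q.2 + (ε * |q.1.1.1 - q.1.1.2|) • q.1.2) hω
    · exact (by fun_prop : Measurable fun q : ((ℝ × ℝ) × Plane n) × Plane n =>
        q.2 + -((ε * |q.1.1.1 - q.1.1.2|) • q.1.2)) hω
  have h1 := ((measurable_symBlowup s ε hw).comp
    (by fun_prop : Measurable fun q : ((ℝ × ℝ) × Plane n) × Plane n =>
      (q.1.1, (q.1.2, q.2)))).indicator hS
  have h2 := h1.lintegral_prod_right' (ν := volume)
  convert h2 using 2 with p
  exact (lintegral_indicator ((measurableSet_pairSet hω _).inter (measurableSet_pairSet hω _))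
    _).symm

/-- With `A`, `B` the quotients in directions `ξ` and `-ξ`, the symmetric quotient is `(A - B)/2`,
and `2((A - B)/2)² ≤ A² + B²`. The value `w(x, εt)` cancels in `A - B`, which decouples the two
heights. -/
theorem symBlowup_le {n : ℕ} (s ε : ℝ) (w : Plane n × ℝ → ℝ) (t τ : ℝ) (ξ x : Plane n) :
    2 * symBlowup s ε w t τ ξ x ≤ blowup s ε w t τ ξ x + blowup s ε w t τ (-ξ) x := by
  have hk := (kern_pos n s ξ).le
  have h2 (z : ℝ) : 2 * ENNReal.ofReal z = ENNReal.ofReal (2 * z) := by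
    rw [ENNReal.ofReal_mul (by norm_num), ENNReal.ofReal_ofNat]
  rw [symBlowup, blowup, blowup, kern_neg, ← ENNReal.ofReal_add (by positivity) (by positivity),
    h2, smul_neg, ← sub_eq_add_neg, ← mul_add]
  refine ENNReal.ofReal_le_ofReal ?_
  rw [mul_left_comm]
  refine mul_le_mul_of_nonneg_left ?_ (by positivity)
  generalize w (x + (ε * |t - τ|) • ξ, ε * τ) = a
  generalize w (x - (ε * |t - τ|) • ξ, ε * τ) = b
  generalize w (x, ε * t) = c
  have : (a - b) / (2 * (ε * |t - τ|)) = ((a - c) / (ε * |t - τ|) - (b - c) / (ε * |t - τ|)) / 2 := by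
    rw [← sub_div, div_div, mul_comm (2 : ℝ)]; ring
  rw [this]
  nlinarith [sq_nonneg ((a - c) / (ε * |t - τ|) + (b - c) / (ε * |t - τ|))]

/-- After integration over `ξ` the two terms of `symBlowup_le` contribute equally, by `ξ ↦ -ξ`, so
no constant is lost. Restricting to points where both shifts stay in `ω` only lowers the left side.
-/
theorem lintegral_symBlowup_le {n : ℕ} {ω : Set (Plane n)} (hω : MeasurableSet ω) (s ε : ℝ)
    {w : Plane n × ℝ → ℝ} (hw : Measurable w) (t τ : ℝ) :
    ∫⁻ ξ, ∫⁻ x in tripleSet ω ((ε * |t - τ|) • ξ), symBlowup s ε w t τ ξ x ≤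
      ∫⁻ ξ, ∫⁻ x in pairSet ω ((ε * |t - τ|) • ξ), blowup s ε w t τ ξ x := by
  set h := ε * |t - τ|
  set J := fun ξ : Plane n => ∫⁻ x in pairSet ω (h • ξ), blowup s ε w t τ ξ x
  have hJ : Measurable J := by
    have h1 : Measurable fun p : Plane n × Plane n =>
        ({q : Plane n × Plane n | q.2 ∈ ω ∧ q.2 + h • q.1 ∈ ω}.indicator
          fun q => blowup s ε w t τ q.1 q.2) p := by
      refine ((measurable_blowup s ε hw).comp
        (by fun_prop : Measurable fun q : Plane n × Plane n => ((t, τ), q))).indicator ?_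
      exact (measurable_snd hω).inter
        ((by fun_prop : Measurable fun q : Plane n × Plane n => q.2 + h • q.1) hω)
    have h2 := h1.lintegral_prod_right' (ν := volume)
    convert h2 using 2 with ξ
    exact (lintegral_indicator (measurableSet_pairSet hω (h • ξ)) _).symm
  have key : ∀ ξ : Plane n, 2 * ∫⁻ x in tripleSet ω (h • ξ), symBlowup s ε w t τ ξ x ≤
      J ξ + J (-ξ) := by
    intro ξ
    rw [← lintegral_const_mul' _ _ (by simp)]
    calc _ ≤ ∫⁻ x in tripleSet ω (h • ξ), (blowup s ε w t τ ξ x + blowup s ε w t τ (-ξ) x) :=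
          lintegral_mono fun x => symBlowup_le s ε w t τ ξ x
      _ = (∫⁻ x in tripleSet ω (h • ξ), blowup s ε w t τ ξ x) +
          ∫⁻ x in tripleSet ω (h • ξ), blowup s ε w t τ (-ξ) x :=
          lintegral_add_left ((measurable_blowup s ε hw).comp
            (by fun_prop : Measurable fun x : Plane n => ((t, τ), (ξ, x)))) _
      _ ≤ _ := by
          refine add_le_add (lintegral_mono_set inter_subset_left) ?_
          simp only [J, smul_neg]
          exact lintegral_mono_set inter_subset_right
  have h2 : 2 * ∫⁻ ξ, ∫⁻ x in tripleSet ω (h • ξ), symBlowup s ε w t τ ξ x ≤ 2 * ∫⁻ ξ, J ξ := by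
    rw [← lintegral_const_mul' _ _ (by simp)]
    refine (lintegral_mono key).trans ?_
    rw [lintegral_add_left hJ, lintegral_neg_eq_self J, two_mul]
  exact (ENNReal.mul_le_mul_iff_right (by simp) (by simp)).1 h2

theorem lintegral_symBlowup_le_scaledEnergy {n : ℕ} {ω : Set (Plane n)} (hω : MeasurableSet ω)
    {s ε : ℝ} (hε : 0 < ε) {w : Plane n × ℝ → ℝ} (hw : Measurable w) :
    ∫⁻ t in Ioo (0 : ℝ) 1, ∫⁻ τ in Ioo (0 : ℝ) 1, ∫⁻ ξ,
      ∫⁻ x in tripleSet ω ((ε * |t - τ|) • ξ), symBlowup s ε w t τ ξ x ≤ scaledEnergy ω s ε w := by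
  rw [scaledEnergy_eq_blowup hω hε hw]
  exact lintegral_mono fun t => lintegral_mono fun τ => lintegral_symBlowup_le hω s ε hw t τ

/-! ### Lower semicontinuity of difference quotients -/

theorem ofReal_integral_le_lintegral_ofReal {α : Type*} [MeasurableSpace α] {μ : Measure α}
    {f : α → ℝ} (hf : Integrable f μ) :
    ENNReal.ofReal (∫ x, f x ∂μ) ≤ ∫⁻ x, ENNReal.ofReal (f x) ∂μ := by
  have h1 := ofReal_integral_eq_lintegral_ofReal hf.pos_part
    (Eventually.of_forall fun x => le_max_right _ _)
  calc ENNReal.ofReal (∫ x, f x ∂μ) ≤ ENNReal.ofReal (∫ x, max (f x) 0 ∂μ) :=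
        ENNReal.ofReal_le_ofReal (integral_mono hf hf.pos_part fun x => le_max_left _ _)
    _ = ∫⁻ x, ENNReal.ofReal (f x) ∂μ := by
        rw [h1]; exact lintegral_congr fun x => by simp [ENNReal.ofReal, Real.toNNReal]

/-- The symmetric difference quotient of `ψ` with step `h` in the direction `ξ`. -/
def symQuot {n : ℕ} (ψ : Plane n → ℝ) (h : ℝ) (ξ y : Plane n) : ℝ :=
  (ψ (y + h • ξ) - ψ (y - h • ξ)) / (2 * h)

/-- The symmetric quotient is the mean of the forward and backward slopes. -/
theorem tendsto_symQuot {n : ℕ} {ψ : Plane n → ℝ} (hψ : Differentiable ℝ ψ) (ξ y : Plane n)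
    {h : ℕ → ℝ} (hpos : ∀ j, 0 < h j) (hlim : Tendsto h atTop (𝓝 0)) :
    Tendsto (fun j => symQuot ψ (h j) ξ y) atTop (𝓝 (fderiv ℝ ψ y ξ)) := by
  have hd : HasDerivAt (fun t : ℝ => ψ (y + t • ξ)) (fderiv ℝ ψ y ξ) 0 := by
    have h1 : HasFDerivAt ψ (fderiv ℝ ψ y) (y + (0 : ℝ) • ξ) := by
      simpa using (hψ y).hasFDerivAt
    have h2 : HasDerivAt (fun t : ℝ => y + t • ξ) ξ 0 := by
      simpa using ((hasDerivAt_id (0 : ℝ)).smul_const ξ).const_add y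
    exact h1.comp_hasDerivAt (0 : ℝ) h2
  have hs := hd.tendsto_slope_zero
  have l1 : Tendsto h atTop (𝓝[≠] 0) := tendsto_nhdsWithin_iff.2
    ⟨hlim, Eventually.of_forall fun j => (hpos j).ne'⟩
  have l2 : Tendsto (fun j => -h j) atTop (𝓝[≠] 0) := tendsto_nhdsWithin_iff.2
    ⟨by simpa using hlim.neg, Eventually.of_forall fun j => neg_ne_zero.2 (hpos j).ne'⟩
  have h3 := ((hs.comp l1).add (hs.comp l2)).div_const 2
  rw [add_self_div_two] at h3
  refine h3.congr fun j => ?_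
  have := (hpos j).ne'
  simp only [Function.comp_apply, symQuot, smul_eq_mul, zero_add, zero_smul, add_zero, neg_smul,
    ← sub_eq_add_neg, inv_neg]
  field_simp
  ring

theorem abs_symQuot_le {n : ℕ} {ψ : Plane n → ℝ} {C : NNReal} (hC : LipschitzWith C ψ) {h : ℝ}
    (hh : 0 < h) (ξ y : Plane n) : |symQuot ψ h ξ y| ≤ C * ‖ξ‖ := by
  have h1 := hC.dist_le_mul (y + h • ξ) (y - h • ξ)
  have h2 : dist (y + h • ξ) (y - h • ξ) = 2 * h * ‖ξ‖ := by
    rw [dist_eq_norm, show y + h • ξ - (y - h • ξ) = (2 * h) • ξ by module, norm_smul,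
      Real.norm_of_nonneg (by positivity)]
  rw [h2, Real.dist_eq] at h1
  rw [symQuot, abs_div, abs_of_pos (by positivity : 0 < 2 * h), div_le_iff₀ (by positivity)]
  linarith

theorem continuous_symQuot {n : ℕ} {ψ : Plane n → ℝ} (hψ : Continuous ψ) (h : ℝ) (ξ : Plane n) :
    Continuous (symQuot ψ h ξ) := by
  unfold symQuot; fun_prop

/-- Discrete integration by parts. -/
theorem integral_symQuot_mul {n : ℕ} {V ψ : Plane n → ℝ} (hV : Integrable V)
    (hψ : Continuous ψ) {C : ℝ} (hC : ∀ x, ‖ψ x‖ ≤ C) (h : ℝ) (ξ : Plane n) :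
    Integrable (fun x => symQuot V h ξ x * ψ x) ∧
    ∫ x, symQuot V h ξ x * ψ x = - ∫ y, V y * symQuot ψ h ξ y := by
  have i1 : Integrable fun x => V (x + h • ξ) * ψ x :=
    (hV.comp_add_right _).mul_bdd hψ.aestronglyMeasurable (Eventually.of_forall hC)
  have i2 : Integrable fun x => V (x - h • ξ) * ψ x :=
    (hV.comp_sub_right _).mul_bdd hψ.aestronglyMeasurable (Eventually.of_forall hC)
  have i3 : Integrable fun x => V x * ψ (x - h • ξ) :=
    hV.mul_bdd (by fun_prop) (Eventually.of_forall fun x => hC _)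
  have i4 : Integrable fun x => V x * ψ (x + h • ξ) :=
    hV.mul_bdd (by fun_prop) (Eventually.of_forall fun x => hC _)
  have e1 : (fun x => symQuot V h ξ x * ψ x) =
      fun x => (V (x + h • ξ) * ψ x - V (x - h • ξ) * ψ x) / (2 * h) := by
    ext x; rw [symQuot]; ring
  have e2 : (fun x => V x * symQuot ψ h ξ x) =
      fun x => (V x * ψ (x + h • ξ) - V x * ψ (x - h • ξ)) / (2 * h) := by
    ext x; rw [symQuot]; ring
  rw [e1, e2]
  refine ⟨(i1.sub i2).div_const _, ?_⟩
  rw [integral_div, integral_div, integral_sub i1 i2, integral_sub i4 i3]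
  have f1 : ∫ x, V (x + h • ξ) * ψ x = ∫ x, V x * ψ (x - h • ξ) := by
    rw [← integral_add_right_eq_self (fun x => V x * ψ (x - h • ξ)) (h • ξ)]
    simp
  have f2 : ∫ x, V (x - h • ξ) * ψ x = ∫ x, V x * ψ (x + h • ξ) := by
    rw [← integral_sub_right_eq_self (fun x => V x * ψ (x + h • ξ)) (h • ξ)]
    simp
  rw [f1, f2]
  ring

/-- Integrating `q² ≥ 2qψ - ψ²` and moving the quotient from `v` to `ψ` replaces a nonlinear
functional of `v` by one that is affine in `v`. Since `h ‖ξ‖ ≤ δ`, the points `x ± hξ` with `x` in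
the support of `ψ` stay in the thickening. -/
theorem le_lintegral_symQuot_sq {n : ℕ} {ω : Set (Plane n)} {v ψ : Plane n → ℝ}
    (hψ : Continuous ψ) (hsupp : HasCompactSupport ψ) {δ : ℝ}
    (hK : Metric.cthickening δ (tsupport ψ) ⊆ ω)
    (hv : IntegrableOn v (Metric.cthickening δ (tsupport ψ))) {h : ℝ} {ξ : Plane n} (hh : 0 < h)
    (hδ : h * ‖ξ‖ ≤ δ) {c : ℝ} (hc : 0 ≤ c) :
    ENNReal.ofReal (c * (-2 * (∫ y in Metric.cthickening δ (tsupport ψ), v y * symQuot ψ h ξ y) -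
      ∫ x, ψ x ^ 2)) ≤
    ∫⁻ x in tripleSet ω (h • ξ), ENNReal.ofReal (c * symQuot v h ξ x ^ 2) := by
  set S := tsupport ψ
  set K := Metric.cthickening δ S
  have hKm : MeasurableSet K := Metric.isClosed_cthickening.measurableSet
  have hmem : ∀ x ∈ S, x ∈ K ∧ x + h • ξ ∈ K ∧ x - h • ξ ∈ K := by
    intro x hx
    have hn : ‖h • ξ‖ ≤ δ := by rwa [norm_smul, Real.norm_of_nonneg hh.le]
    refine ⟨Metric.self_subset_cthickening _ hx, ?_, ?_⟩
    · exact Metric.mem_cthickening_of_dist_le _ x δ S hx (by simpa [dist_eq_norm] using hn)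
    · exact Metric.mem_cthickening_of_dist_le _ x δ S hx (by simpa [dist_eq_norm] using hn)
  have hSsub : S ⊆ tripleSet ω (h • ξ) := fun x hx => by
    obtain ⟨h1, h2, h3⟩ := hmem x hx
    exact ⟨⟨hK h1, hK h2⟩, hK h1, by rw [← sub_eq_add_neg]; exact hK h3⟩
  -- The cut-off is integrable on the whole space, as translation invariance requires, and has the
  -- quotient of `v` on the support of `ψ`.
  set V := K.indicator v
  have hV : Integrable V := hv.integrable_indicator hKm
  obtain ⟨C, hC⟩ := hψ.bounded_above_of_compact_support hsupp
  obtain ⟨i1, e1⟩ := integral_symQuot_mul hV hψ hC h ξ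
  have i2 : Integrable fun x => ψ x ^ 2 := by
    have h1 : Integrable ψ := hψ.integrable_of_hasCompactSupport hsupp
    simpa only [sq] using h1.mul_bdd hψ.aestronglyMeasurable (Eventually.of_forall hC)
  have e2 : ∫ y in K, v y * symQuot ψ h ξ y = ∫ y, V y * symQuot ψ h ξ y := by
    rw [← integral_indicator hKm]
    congr 1 with y
    by_cases hy : y ∈ K <;> simp [V, hy]
  have e3 : c * (-2 * (∫ y in K, v y * symQuot ψ h ξ y) - ∫ x, ψ x ^ 2) =
      ∫ x, c * (2 * (symQuot V h ξ x * ψ x) - ψ x ^ 2) := by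
    rw [integral_const_mul, integral_sub (i1.const_mul 2) i2, integral_const_mul, e1, e2]
    ring
  have i3 : Integrable fun x => c * (2 * (symQuot V h ξ x * ψ x) - ψ x ^ 2) :=
    ((i1.const_mul 2).sub i2).const_mul c
  rw [e3]
  calc _ ≤ ∫⁻ x, ENNReal.ofReal (c * (2 * (symQuot V h ξ x * ψ x) - ψ x ^ 2)) :=
        ofReal_integral_le_lintegral_ofReal i3
    _ ≤ ∫⁻ x, S.indicator (fun x => ENNReal.ofReal (c * symQuot v h ξ x ^ 2)) x := by
        refine lintegral_mono fun x => ?_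
        by_cases hx : x ∈ S
        · obtain ⟨-, h2, h3⟩ := hmem x hx
          have : symQuot V h ξ x = symQuot v h ξ x := by
            simp only [symQuot, V, indicator_of_mem h2, indicator_of_mem h3]
          rw [indicator_of_mem hx, this]
          refine ENNReal.ofReal_le_ofReal (mul_le_mul_of_nonneg_left ?_ hc)
          nlinarith [sq_nonneg (symQuot v h ξ x - ψ x)]
        · simp [image_eq_zero_of_notMem_tsupport hx]
    _ = ∫⁻ x in S, ENNReal.ofReal (c * symQuot v h ξ x ^ 2) :=
        lintegral_indicator (isClosed_tsupport ψ).measurableSet _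
    _ ≤ _ := lintegral_mono_set hSsub

/-- Lower semicontinuity of difference quotients: if `v j → u` in `L¹` near the support of `ψ`,
and `u` has weak gradient `g`, then the squared symmetric quotients dominate in the limit the
duality pairing of `⟨g, ξ⟩` with `ψ`. -/
theorem le_liminf_lintegral_symQuot_sq {n : ℕ} {ω : Set (Plane n)} {u ψ : Plane n → ℝ}
    {g : Plane n → Plane n} (hg : IsWeakGradient ω u g)
    (hψ : ContDiff ℝ (⊤ : ℕ∞) ψ) (hsupp : HasCompactSupport ψ) {δ : ℝ} (hδ : 0 < δ)
    (hK : Metric.cthickening δ (tsupport ψ) ⊆ ω)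
    (hu : IntegrableOn u (Metric.cthickening δ (tsupport ψ)))
    {v : ℕ → Plane n → ℝ} (hv : ∀ j, Measurable (v j))
    (hvu : Tendsto (fun j => ∫⁻ x in Metric.cthickening δ (tsupport ψ), ‖v j x - u x‖ₑ)
      atTop (𝓝 0))
    {h : ℕ → ℝ} (hpos : ∀ j, 0 < h j) (hlim : Tendsto h atTop (𝓝 0)) (ξ : Plane n)
    {c : ℕ → ℝ} (hc : ∀ j, 0 ≤ c j) {c₀ : ℝ} (hc₀ : Tendsto c atTop (𝓝 c₀)) :
    ENNReal.ofReal (c₀ * (2 * (∫ x in ω, inner ℝ (g x) ξ * ψ x) - ∫ x, ψ x ^ 2)) ≤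
      liminf (fun j => ∫⁻ x in tripleSet ω (h j • ξ),
        ENNReal.ofReal (c j * symQuot (v j) (h j) ξ x ^ 2)) atTop := by
  set S := tsupport ψ
  set K := Metric.cthickening δ S
  have hKm : MeasurableSet K := Metric.isClosed_cthickening.measurableSet
  have hSK : S ⊆ K := Metric.self_subset_cthickening _
  obtain ⟨C, hC⟩ := (hψ.of_le (by simp : (1 : WithTop ℕ∞) ≤ _)).lipschitzWith_of_hasCompactSupport
    hsupp one_ne_zero
  have hD : Differentiable ℝ ψ := hψ.differentiable (by simp)
  have hsub : ∀ᶠ j in atTop, Integrable (fun x => v j x - u x) (volume.restrict K) := by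
    filter_upwards [hvu.eventually_lt_const ENNReal.zero_lt_top] with j hj
    exact ⟨(hv j).aestronglyMeasurable.sub hu.aestronglyMeasurable, hj⟩
  have hsq : ∀ j, AEStronglyMeasurable (symQuot ψ (h j) ξ) (volume.restrict K) := fun j =>
    (continuous_symQuot hψ.continuous _ _).aestronglyMeasurable
  have hsqb : ∀ j, ∀ᵐ x ∂volume.restrict K, ‖symQuot ψ (h j) ξ x‖ ≤ C * ‖ξ‖ := fun j =>
    Eventually.of_forall fun x => abs_symQuot_le hC (hpos j) ξ x
  have l1 : Tendsto (fun j => ∫ y in K, u y * symQuot ψ (h j) ξ y) atTop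
      (𝓝 (∫ y in K, u y * fderiv ℝ ψ y ξ)) := by
    refine tendsto_integral_of_dominated_convergence (fun y => ‖u y‖ * (C * ‖ξ‖))
      (fun j => hu.aestronglyMeasurable.mul (hsq j)) (hu.norm.mul_const _) (fun j => ?_) ?_
    · filter_upwards [hsqb j] with x hx
      rw [norm_mul]; gcongr
    · exact Eventually.of_forall fun y => (tendsto_symQuot hD ξ y hpos hlim).const_mul _
  -- The quotients of `ψ` are bounded by `C ‖ξ‖` uniformly in `j`, so `L¹` convergence of `v j` to
  -- `u` is enough.
  have l2 : Tendsto (fun j => ∫ y in K, (v j y - u y) * symQuot ψ (h j) ξ y) atTop (𝓝 0) := by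
    have hb : Tendsto (fun j => (∫⁻ x in K, ‖v j x - u x‖ₑ).toReal * (C * ‖ξ‖)) atTop (𝓝 0) := by
      simpa using ((ENNReal.tendsto_toReal ENNReal.zero_ne_top).comp hvu).mul_const (C * ‖ξ‖)
    refine squeeze_zero_norm' ?_ hb
    filter_upwards [hsub] with j hj
    calc _ ≤ ∫ y in K, ‖v j y - u y‖ * (C * ‖ξ‖) := by
          refine norm_integral_le_of_norm_le (hj.norm.mul_const _) ?_
          filter_upwards [hsqb j] with x hx
          rw [norm_mul]; gcongr
      _ = _ := by
          rw [integral_mul_const, integral_norm_eq_lintegral_enorm hj.aestronglyMeasurable]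
  have l3 : Tendsto (fun j => ∫ y in K, v j y * symQuot ψ (h j) ξ y) atTop
      (𝓝 (∫ y in K, u y * fderiv ℝ ψ y ξ)) := by
    have := l1.add l2
    rw [add_zero] at this
    refine this.congr' ?_
    filter_upwards [hsub] with j hj
    rw [← integral_add (hu.mul_bdd (hsq j) (hsqb j)) (hj.mul_bdd (hsq j) (hsqb j))]
    congr 1 with y
    ring
  -- Here the weak gradient enters; the derivative of `ψ` vanishes off `K`, so the domain of
  -- integration may be changed from `K` to `ω`.
  have hibp : ∫ y in K, u y * fderiv ℝ ψ y ξ = - ∫ x in ω, inner ℝ (g x) ξ * ψ x := by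
    rw [← hg ψ hψ hsupp (hSK.trans hK) ξ]
    have hz : ∀ x ∉ K, u x * fderiv ℝ ψ x ξ = 0 := fun x hx => by
      rw [image_eq_zero_of_notMem_tsupport fun h => hx (hSK (tsupport_fderiv_subset ℝ h))]
      simp
    rw [setIntegral_eq_integral_of_forall_compl_eq_zero hz,
      setIntegral_eq_integral_of_forall_compl_eq_zero fun x hx => hz x fun h => hx (hK h)]
  have l4 : Tendsto (fun j => ENNReal.ofReal (c j * (-2 * (∫ y in K, v j y * symQuot ψ (h j) ξ y) -
      ∫ x, ψ x ^ 2))) atTop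
      (𝓝 (ENNReal.ofReal (c₀ * (2 * (∫ x in ω, inner ℝ (g x) ξ * ψ x) - ∫ x, ψ x ^ 2)))) := by
    refine (ENNReal.continuous_ofReal.tendsto _).comp (hc₀.mul ?_)
    have := (l3.const_mul (-2)).sub_const (∫ x, ψ x ^ 2)
    rw [hibp] at this
    convert this using 2
    ring
  rw [← l4.liminf_eq]
  refine liminf_le_liminf ?_
  have hsm : ∀ᶠ j in atTop, h j * ‖ξ‖ ≤ δ := by
    have : Tendsto (fun j => h j * ‖ξ‖) atTop (𝓝 0) := by simpa using hlim.mul_const ‖ξ‖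
    exact this.eventually_le_const hδ
  filter_upwards [hsub, hsm] with j hj hj2
  have hvj : IntegrableOn (v j) K := by
    have := hj.add hu
    refine this.congr (Eventually.of_forall fun x => by simp)
  exact le_lintegral_symQuot_sq hψ.continuous hsupp hK hvj (hpos j) hj2 (hc j)

/-! ### The lower bound with a test field -/

/-- The directional energy `∫_ω ⟨f, ξ⟩²`. -/
def dirEnergy {n : ℕ} (ω : Set (Plane n)) (f : Plane n → Plane n) (ξ : Plane n) : ℝ≥0∞ :=
  ∫⁻ x in ω, ENNReal.ofReal (inner ℝ (f x) ξ ^ 2)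

theorem aemeasurable_dirEnergy {n : ℕ} {ω : Set (Plane n)} {f : Plane n → Plane n}
    (hf : AEMeasurable f (volume.restrict ω)) : AEMeasurable (dirEnergy ω f) volume := by
  have h1 : AEMeasurable (fun p : Plane n × Plane n => f p.2)
      (volume.prod (volume.restrict ω)) :=
    hf.comp_quasiMeasurePreserving Measure.quasiMeasurePreserving_snd
  have h2 : AEMeasurable (fun p : Plane n × Plane n => ENNReal.ofReal (inner ℝ (f p.2) p.1 ^ 2))
      (volume.prod (volume.restrict ω)) := by fun_prop
  exact h2.lintegral_prod_right'

theorem memLp_inner_const {n : ℕ} {μ : Measure (Plane n)} {f : Plane n → Plane n}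
    (hf : MemLp f 2 μ) (ξ : Plane n) : MemLp (fun x => inner ℝ (f x) ξ) 2 μ :=
  hf.inner_const ξ

/-- Equality would hold between real integrals: `a² = (2ab - b²) + (a - b)²`. The inequality appears
because the first bracket may have negative integral, which `ENNReal.ofReal` truncates. -/
theorem dirEnergy_le {n : ℕ} {ω : Set (Plane n)} {g Φ : Plane n → Plane n}
    (hg : MemLp g 2 (volume.restrict ω)) (hΦ : MemLp Φ 2 (volume.restrict ω))
    (hsupp : tsupport Φ ⊆ ω) (ξ : Plane n) :
    dirEnergy ω g ξ ≤ ENNReal.ofReal (2 * (∫ x in ω, inner ℝ (g x) ξ * inner ℝ (Φ x) ξ) -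
      ∫ x, inner ℝ (Φ x) ξ ^ 2) + dirEnergy ω (g - Φ) ξ := by
  have hg' := memLp_inner_const hg ξ
  have hΦ' := memLp_inner_const hΦ ξ
  have hd' := memLp_inner_const (hg.sub hΦ) ξ
  have e1 : ∫ x, inner ℝ (Φ x) ξ ^ 2 = ∫ x in ω, inner ℝ (Φ x) ξ ^ 2 := by
    refine (setIntegral_eq_integral_of_forall_compl_eq_zero fun x hx => ?_).symm
    rw [image_eq_zero_of_notMem_tsupport fun h => hx (hsupp h)]
    simp
  have e2 : ∀ {f : Plane n → Plane n}, MemLp (fun x => inner ℝ (f x) ξ) 2 (volume.restrict ω) →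
      dirEnergy ω f ξ = ENNReal.ofReal (∫ x in ω, inner ℝ (f x) ξ ^ 2) := fun hf =>
    (ofReal_integral_eq_lintegral_ofReal hf.integrable_sq
      (Eventually.of_forall fun x => sq_nonneg _)).symm
  rw [e1, e2 hg', e2 hd']
  refine le_trans (le_of_eq ?_) ENNReal.ofReal_add_le
  have i1 : Integrable (fun x => inner ℝ (g x) ξ * inner ℝ (Φ x) ξ) (volume.restrict ω) :=
    hg'.integrable_mul hΦ'
  rw [← integral_const_mul, ← integral_sub (i1.const_mul 2) hΦ'.integrable_sq,
    ← integral_add (by exact (i1.const_mul 2).sub hΦ'.integrable_sq) hd'.integrable_sq]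
  congr 2 with x
  simp only [Pi.sub_apply, inner_sub_left]
  ring

/-- Fatou's lemma with the error kept on the right, where no subtraction in `ℝ≥0∞` is needed. -/
theorem lintegral_le_liminf_add {α : Type*} [MeasurableSpace α] {μ : Measure α}
    {F : ℕ → α → ℝ≥0∞} (hF : ∀ j, Measurable (F j)) {a b : α → ℝ≥0∞} (hb : AEMeasurable b μ)
    (h : ∀ᵐ p ∂μ, a p ≤ liminf (fun j => F j p) atTop + b p) :
    ∫⁻ p, a p ∂μ ≤ liminf (fun j => ∫⁻ p, F j p ∂μ) atTop + ∫⁻ p, b p ∂μ :=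
  calc _ ≤ ∫⁻ p, (liminf (fun j => F j p) atTop + b p) ∂μ := lintegral_mono_ae h
    _ = (∫⁻ p, liminf (fun j => F j p) atTop ∂μ) + ∫⁻ p, b p ∂μ := lintegral_add_right' _ hb
    _ ≤ _ := by gcongr; exact lintegral_liminf_le hF

/-- The lower bound, with an error measured by the distance of the weak gradient to a test field,
for sequences whose sections converge in `L¹` at almost every height `τ ∈ I`. -/
theorem le_liminf_scaledEnergy_add {n : ℕ} (hn : 1 ≤ n) {ω : Set (Plane n)} (hω : IsOpen ω)
    {u : Plane n → ℝ} {g Φ : Plane n → Plane n} (hg : IsWeakGradient ω u g)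
    (hgL : MemLp g 2 (volume.restrict ω)) (hΦ : ContDiff ℝ (⊤ : ℕ∞) Φ)
    (hsupp : HasCompactSupport Φ) {δ : ℝ} (hδ : 0 < δ)
    (hK : Metric.cthickening δ (tsupport Φ) ⊆ ω)
    (hu : IntegrableOn u (Metric.cthickening δ (tsupport Φ)))
    {w : ℕ → Plane n × ℝ → ℝ} (hw : ∀ j, Measurable (w j))
    {e : ℕ → ℝ} (he : ∀ j, 0 < e j) (he0 : Tendsto e atTop (𝓝 0))
    {s : ℕ → ℝ} {s₀ : ℝ} (hs₀ : 1 / 2 < s₀) (hs : Tendsto s atTop (𝓝 s₀))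
    {I : Set ℝ} (hI : I ⊆ Ioo 0 1)
    (hwu : ∀ᵐ τ ∂volume.restrict I, Tendsto (fun j =>
      ∫⁻ x in Metric.cthickening δ (tsupport Φ), ‖w j (x, e j * τ) - u x‖ₑ) atTop (𝓝 0)) :
    (∫⁻ t in Ioo (0 : ℝ) 1, ∫⁻ τ in I, ENNReal.ofReal (|t - τ| ^ (1 - 2 * s₀))) *
      (ENNReal.ofReal (kernMoment n s₀) * ∫⁻ x in ω, ENNReal.ofReal (‖g x‖ ^ 2)) ≤
    liminf (fun j => scaledEnergy ω (s j) (e j) (w j)) atTop +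
    (∫⁻ t in Ioo (0 : ℝ) 1, ∫⁻ τ in I, ENNReal.ofReal (|t - τ| ^ (1 - 2 * s₀))) *
      (ENNReal.ofReal (kernMoment n s₀) * ∫⁻ x in ω, ENNReal.ofReal (‖(g - Φ) x‖ ^ 2)) := by
  have hΦL : MemLp Φ 2 (volume.restrict ω) :=
    (hΦ.continuous.memLp_of_hasCompactSupport hsupp).restrict ω
  have hsub : tsupport Φ ⊆ ω := (Metric.self_subset_cthickening _).trans hK
  set ν : Measure (ℝ × ℝ) := (volume.restrict (Ioo (0 : ℝ) 1)).prod (volume.restrict I)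
  set A : ℝ × ℝ → ℝ≥0∞ := fun p => ENNReal.ofReal (|p.1 - p.2| ^ (1 - 2 * s₀))
  have hA : Measurable A := by fun_prop
  set Q : ℕ → (ℝ × ℝ) × Plane n → ℝ≥0∞ := fun j p =>
    ∫⁻ x in tripleSet ω ((e j * |p.1.1 - p.1.2|) • p.2), symBlowup (s j) (e j) (w j) p.1.1 p.1.2 p.2 x
  have hQ : ∀ j, Measurable (Q j) := fun j =>
    measurable_lintegral_symBlowup hω.measurableSet (s j) (e j) (hw j)
  have hB : ∀ {f : Plane n → Plane n}, AEMeasurable f (volume.restrict ω) →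
      AEMeasurable (fun ξ => ENNReal.ofReal (kern n s₀ ξ) * dirEnergy ω f ξ) volume := fun hf => by
    have := aemeasurable_dirEnergy hf
    fun_prop
  have hT : ∫⁻ p, A p ∂ν =
      ∫⁻ t in Ioo (0 : ℝ) 1, ∫⁻ τ in I, ENNReal.ofReal (|t - τ| ^ (1 - 2 * s₀)) :=
    lintegral_prod _ hA.aemeasurable
  have hprod : ∀ {f : Plane n → Plane n}, AEMeasurable f (volume.restrict ω) →
      ∫⁻ p, A p.1 * (ENNReal.ofReal (kern n s₀ p.2) * dirEnergy ω f p.2) ∂ν.prod volume =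
      (∫⁻ t in Ioo (0 : ℝ) 1, ∫⁻ τ in I, ENNReal.ofReal (|t - τ| ^ (1 - 2 * s₀))) *
      (ENNReal.ofReal (kernMoment n s₀) * ∫⁻ x in ω, ENNReal.ofReal (‖f x‖ ^ 2)) := fun hf => by
    rw [lintegral_prod_mul hA.aemeasurable (hB hf), hT]
    congr 1
    exact lintegral_kern_mul_lintegral_inner_sq hn hs₀ hf
  have hgm : AEMeasurable g (volume.restrict ω) := hgL.aestronglyMeasurable.aemeasurable
  have hgΦm : AEMeasurable (g - Φ) (volume.restrict ω) :=
    (hgL.sub hΦL).aestronglyMeasurable.aemeasurable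
  have key : ∀ᵐ p ∂ν.prod (volume : Measure (Plane n)),
      A p.1 * (ENNReal.ofReal (kern n s₀ p.2) * dirEnergy ω g p.2) ≤
      liminf (fun j => Q j p) atTop +
        A p.1 * (ENNReal.ofReal (kern n s₀ p.2) * dirEnergy ω (g - Φ) p.2) := by
    have hq : Measure.QuasiMeasurePreserving (fun p : (ℝ × ℝ) × Plane n => p.1.2)
        (ν.prod volume) (volume.restrict I) :=
      Measure.quasiMeasurePreserving_snd.comp Measure.quasiMeasurePreserving_fst
    filter_upwards [hq.ae hwu] with p hp
    obtain ⟨⟨t, τ⟩, ξ⟩ := p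
    simp only at hp ⊢
    -- On the diagonal the weight is `0`, by the convention `0 ^ r = 0` for `r ≠ 0`.
    rcases eq_or_ne t τ with rfl | htτ
    · simp [A, Real.zero_rpow (by linarith : 1 - 2 * s₀ ≠ 0)]
    have hd : 0 < |t - τ| := abs_pos.2 (sub_ne_zero.2 htτ)
    have hψs : tsupport (fun x => inner ℝ (Φ x) ξ) ⊆ tsupport Φ := by
      refine closure_mono fun x hx => ?_
      simp only [Function.mem_support] at hx ⊢
      rintro h; simp [h] at hx
    have hcs : HasCompactSupport fun x => inner ℝ (Φ x) ξ :=
      hsupp.of_isClosed_subset (isClosed_tsupport _) hψs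
    have hKs := Metric.cthickening_subset_of_subset δ hψs
    have hc : Tendsto (fun j => |t - τ| ^ (1 - 2 * s j) * kern n (s j) ξ) atTop
        (𝓝 (|t - τ| ^ (1 - 2 * s₀) * kern n s₀ ξ)) := by
      have h1 : (0 : ℝ) < 1 + ‖ξ‖ ^ 2 := by positivity
      refine Tendsto.mul ?_ ?_
      · exact tendsto_const_nhds.rpow ((hs.const_mul 2).const_sub 1) (Or.inl hd.ne')
      · unfold kern
        exact (tendsto_const_nhds.rpow (hs.const_add _) (Or.inl h1.ne')).inv₀ (by positivity)
    -- The test function is `ψ = ⟨Φ, ξ⟩`, which is near `⟨g, ξ⟩` for every direction when `Φ` is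
    -- near `g`.
    have hmain := le_liminf_lintegral_symQuot_sq hg (ψ := fun x => inner ℝ (Φ x) ξ)
      (hΦ.inner ℝ contDiff_const) hcs hδ (hKs.trans hK) (hu.mono_set hKs)
      (v := fun j x => w j (x, e j * τ)) (fun j => by have := hw j; fun_prop)
      (tendsto_of_tendsto_of_tendsto_of_le_of_le tendsto_const_nhds hp (fun j => zero_le)
        fun j => lintegral_mono_set hKs)
      (h := fun j => e j * |t - τ|) (fun j => mul_pos (he j) hd)
      (by simpa using he0.mul_const |t - τ|) ξ
      (c := fun j => |t - τ| ^ (1 - 2 * s j) * kern n (s j) ξ)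
      (fun j => by have := (kern_pos n (s j) ξ).le; positivity) hc
    have hk := (kern_pos n s₀ ξ).le
    calc _ ≤ A (t, τ) * (ENNReal.ofReal (kern n s₀ ξ) * (ENNReal.ofReal
          (2 * (∫ x in ω, inner ℝ (g x) ξ * inner ℝ (Φ x) ξ) - ∫ x, inner ℝ (Φ x) ξ ^ 2) +
            dirEnergy ω (g - Φ) ξ)) := by
          gcongr; exact dirEnergy_le hgL hΦL hsub ξ
      _ ≤ _ := by
          rw [mul_add, mul_add, ← ENNReal.ofReal_mul hk, ← ENNReal.ofReal_mul (by positivity),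
            ← mul_assoc]
          gcongr
          exact hmain
  have hfin := lintegral_le_liminf_add hQ (hA.comp measurable_fst |>.aemeasurable.mul
    ((hB hgΦm).comp_quasiMeasurePreserving Measure.quasiMeasurePreserving_snd)) key
  simp only [Function.comp_apply, Pi.mul_apply] at hfin
  rw [hprod hgm, hprod hgΦm] at hfin
  refine hfin.trans ?_
  gcongr
  refine liminf_le_liminf (Eventually.of_forall fun j => ?_)
  rw [lintegral_prod _ (hQ j).aemeasurable,
    lintegral_prod _ (hQ j).lintegral_prod_right'.aemeasurable]
  refine le_trans ?_ (lintegral_symBlowup_le_scaledEnergy hω.measurableSet (he j) (hw j))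
  exact lintegral_mono fun t => lintegral_mono_set hI

/-! ### Translation and mollification in `L²` -/

theorem eLpNorm_two_sq {α ε' : Type*} [MeasurableSpace α] {μ : Measure α} [TopologicalSpace ε']
    [ContinuousENorm ε'] (f : α → ε') :
    eLpNorm f 2 μ ^ 2 = ∫⁻ x, ‖f x‖ₑ ^ 2 ∂μ := by
  have := eLpNorm_nnreal_pow_eq_lintegral (μ := μ) (f := f) (p := 2) two_ne_zero
  simp only [ENNReal.coe_ofNat, NNReal.coe_ofNat] at this
  simpa only [← ENNReal.rpow_natCast, Nat.cast_ofNat] using this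

/-- Jensen's inequality for the square, with respect to a probability density. -/
theorem lintegral_mul_sq_le {α : Type*} [MeasurableSpace α] {μ : Measure α} {ρ f : α → ℝ≥0∞}
    (hρ : Measurable ρ) (hρ1 : ∫⁻ z, ρ z ∂μ = 1) (hf : AEMeasurable f μ) :
    (∫⁻ z, ρ z * f z ∂μ) ^ 2 ≤ ∫⁻ z, ρ z * f z ^ 2 ∂μ := by
  have hP : IsProbabilityMeasure (μ.withDensity ρ) := ⟨by simpa using hρ1⟩
  have hf' : AEMeasurable f (μ.withDensity ρ) :=
    hf.mono_ac (withDensity_absolutelyContinuous μ ρ)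
  have h1 := eLpNorm_le_eLpNorm_of_exponent_le (μ := μ.withDensity ρ) (f := f)
    (one_le_two : (1 : ℝ≥0∞) ≤ 2) hf'.aestronglyMeasurable
  have h2 := pow_le_pow_left₀ zero_le h1 2
  rw [eLpNorm_two_sq, eLpNorm_one_eq_lintegral_enorm] at h2
  simp only [enorm_eq_self] at h2
  rwa [lintegral_withDensity_eq_lintegral_mul₀ hρ.aemeasurable hf,
    lintegral_withDensity_eq_lintegral_mul₀ hρ.aemeasurable (hf.pow_const 2)] at h2

/-- Translations are continuous in `L²`. -/
theorem exists_eLpNorm_translate_sub_le {n : ℕ} {F : Type*} [NormedAddCommGroup F]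
    {f : Plane n → F} (hf : MemLp f 2 volume)
    {η : ℝ≥0∞} (hη : η ≠ 0) :
    ∃ r > 0, ∀ b : Plane n, ‖b‖ ≤ r → eLpNorm (fun x => f (x + b) - f x) 2 volume ≤ η := by
  have : Fact ((2 : ℝ≥0∞) ≠ ∞) := ⟨by simp⟩
  -- For finite exponents the translation action on `Lp` is continuous.
  have hc : Continuous fun b : Plane n => DomAddAct.mk b +ᵥ hf.toLp f := by
    fun_prop
  have ht := (EMetric.tendsto_nhds.1 (hc.tendsto 0)) η (pos_iff_ne_zero.2 hη)
  obtain ⟨r, hr, hball⟩ := Metric.eventually_nhds_iff_ball.1 ht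
  refine ⟨r / 2, by positivity, fun b hb => ?_⟩
  have h1 := hball b (by rw [mem_ball_zero_iff]; linarith)
  rw [DomAddAct.mk_zero, zero_vadd, DomAddAct.mk_vadd_toLp, Lp.edist_toLp_toLp] at h1
  refine le_of_eq_of_le ?_ h1.le
  congr 1 with x
  simp [add_comm]

/-- Mollifications composed with small translations converge in `L²`. -/
theorem exists_eLpNorm_mollify_sub_le {n : ℕ} {F : Type*} [NormedAddCommGroup F]
    [NormedSpace ℝ F] [CompleteSpace F] {f : Plane n → F} (hf : MemLp f 2 volume)
    {η : ℝ≥0∞} (hη : η ≠ 0) :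
    ∃ r > 0, ∀ a : Plane n, ‖a‖ ≤ r → ∀ φ : ContDiffBump (0 : Plane n), φ.rOut ≤ r →
      eLpNorm (fun x => (φ.normed volume ⋆[ContinuousLinearMap.lsmul ℝ ℝ, volume] f) (x + a) - f x)
        2 volume ≤ η := by
  obtain ⟨r, hr, htr⟩ := exists_eLpNorm_translate_sub_le hf hη
  -- The total displacement is `a - z` with `‖a‖, ‖z‖ ≤ r/2`.
  refine ⟨r / 2, by positivity, fun a ha φ hφ => ?_⟩
  set ρ := φ.normed (volume : Measure (Plane n))
  have hρc : Continuous ρ := φ.continuous_normed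
  have hρm : Measurable fun z => ENNReal.ofReal (ρ z) := hρc.measurable.ennreal_ofReal
  have hρ0 : ∀ z, 0 ≤ ρ z := φ.nonneg_normed
  have hρ1 : ∫⁻ z, ENNReal.ofReal (ρ z) = 1 := by
    rw [← ofReal_integral_eq_lintegral_ofReal φ.integrable_normed (Eventually.of_forall hρ0),
      φ.integral_normed, ENNReal.ofReal_one]
  have hfl : LocallyIntegrable f volume := hf.locallyIntegrable one_le_two
  have hjm : AEStronglyMeasurable (fun p : Plane n × Plane n => f (p.1 + (a - p.2)) - f p.1)
      (volume.prod volume) := by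
    have h1 : Measure.QuasiMeasurePreserving (fun p : Plane n × Plane n => p.1 + (a - p.2))
        (volume.prod volume) volume := by
      have h2 := quasiMeasurePreserving_sub_of_right_invariant (volume : Measure (Plane n)) volume
      have h3 : MeasurePreserving (fun x : Plane n => x + a) volume volume :=
        measurePreserving_add_right volume a
      have := h3.quasiMeasurePreserving.comp h2
      convert this using 2 with p
      simp only [Function.comp_apply]; abel
    exact (hf.1.comp_quasiMeasurePreserving h1).sub
      (hf.1.comp_quasiMeasurePreserving Measure.quasiMeasurePreserving_fst)
  have hpt : ∀ x, ‖(ρ ⋆[ContinuousLinearMap.lsmul ℝ ℝ, volume] f) (x + a) - f x‖ₑ ≤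
      ∫⁻ z, ENNReal.ofReal (ρ z) * ‖f (x + (a - z)) - f x‖ₑ := by
    intro x
    have i1 : Integrable fun z => ρ z • f (x + a - z) :=
      φ.hasCompactSupport_normed.convolutionExists_left (ContinuousLinearMap.lsmul ℝ ℝ)
        hρc hfl (x + a)
    have i2 : Integrable fun z => ρ z • f x := φ.integrable_normed.smul_const _
    have e1 : (ρ ⋆[ContinuousLinearMap.lsmul ℝ ℝ, volume] f) (x + a) - f x =
        ∫ z, ρ z • (f (x + (a - z)) - f x) := by
      rw [convolution_def]
      simp only [ContinuousLinearMap.lsmul_apply]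
      have : f x = ∫ z, ρ z • f x := by
        rw [integral_smul_const, φ.integral_normed, one_smul]
      conv_lhs => rw [this]
      rw [← integral_sub i1 i2]
      congr 1 with z
      rw [smul_sub, add_sub_assoc]
    rw [e1]
    refine (enorm_integral_le_lintegral_enorm _).trans (le_of_eq (lintegral_congr fun z => ?_))
    rw [enorm_smul, Real.enorm_eq_ofReal (hρ0 z)]
  refine (ENNReal.pow_le_pow_left_iff two_ne_zero).1 ?_
  rw [eLpNorm_two_sq]
  calc _ ≤ ∫⁻ x, ∫⁻ z, ENNReal.ofReal (ρ z) * ‖f (x + (a - z)) - f x‖ₑ ^ 2 := by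
        refine lintegral_mono_ae ?_
        filter_upwards [hjm.prodMk_left] with x hx
        exact (pow_le_pow_left₀ zero_le (hpt x) 2).trans (lintegral_mul_sq_le hρm hρ1 hx.enorm)
    _ = ∫⁻ z, ∫⁻ x, ENNReal.ofReal (ρ z) * ‖f (x + (a - z)) - f x‖ₑ ^ 2 := by
        refine lintegral_lintegral_swap ?_
        exact (hρm.comp measurable_snd).aemeasurable.mul (hjm.enorm.pow_const 2)
    _ ≤ ∫⁻ z, ENNReal.ofReal (ρ z) * η ^ 2 := by
        refine lintegral_mono fun z => ?_
        rw [lintegral_const_mul' _ _ ENNReal.ofReal_ne_top]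
        by_cases hz : z ∈ Metric.ball (0 : Plane n) φ.rOut
        · gcongr
          rw [← eLpNorm_two_sq (f := fun x => f (x + (a - z)) - f x)]
          gcongr
          refine htr _ ((norm_sub_le _ _).trans ?_)
          rw [mem_ball_zero_iff] at hz
          linarith
        · have : ρ z = 0 := by
            rw [← φ.support_normed_eq (μ := volume)] at hz
            exact Function.notMem_support.1 hz
          simp [this]
    _ = η ^ 2 := by rw [lintegral_mul_const _ hρm, hρ1, one_mul]

/-- Along a subsequence with integrals at most `2⁻ᵏ` the series has finite integral, hence is finite
almost everywhere, and its terms tend to `0`. -/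
theorem exists_subseq_ae_tendsto_zero {α : Type*} [MeasurableSpace α] {μ : Measure α}
    {G : ℕ → α → ℝ≥0∞} (hG : ∀ j, Measurable (G j))
    (h : Tendsto (fun j => ∫⁻ x, G j x ∂μ) atTop (𝓝 0)) :
    ∃ φ : ℕ → ℕ, StrictMono φ ∧ ∀ᵐ x ∂μ, Tendsto (fun j => G (φ j) x) atTop (𝓝 0) := by
  obtain ⟨φ, hφ, hle⟩ := extraction_forall_of_eventually'
    (P := fun k j => ∫⁻ x, G j x ∂μ ≤ (2⁻¹ : ℝ≥0∞) ^ k) fun k =>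
      eventually_atTop.1 (h.eventually_le_const (pos_iff_ne_zero.2 (pow_ne_zero k (by simp))))
  refine ⟨φ, hφ, ?_⟩
  have hsum : ∫⁻ x, ∑' k, G (φ k) x ∂μ ≠ ∞ := by
    rw [lintegral_tsum fun k => (hG _).aemeasurable]
    refine ne_top_of_le_ne_top ?_ (ENNReal.tsum_le_tsum hle)
    rw [ENNReal.tsum_geometric]
    simp
  filter_upwards [ae_lt_top (.tsum fun k => hG (φ k)) hsum] with x hx
  exact ENNReal.tendsto_atTop_zero_of_tsum_ne_top hx.ne

/-- Smooth compactly supported fields are dense in `L²(ω)`. -/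
theorem exists_contDiff_eLpNorm_sub_le {n : ℕ} {ω : Set (Plane n)} (hω : IsOpen ω)
    {F : Type*} [NormedAddCommGroup F] [NormedSpace ℝ F] [CompleteSpace F]
    {g : Plane n → F} (hg : MemLp g 2 (volume.restrict ω)) {η : ℝ≥0∞} (hη : η ≠ 0) :
    ∃ Φ : Plane n → F, ContDiff ℝ (⊤ : ℕ∞) Φ ∧ HasCompactSupport Φ ∧ tsupport Φ ⊆ ω ∧
      eLpNorm (g - Φ) 2 (volume.restrict ω) ≤ η := by
  have hη2 : η / 2 ≠ 0 := by simp [hη]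
  have hgm : AEMeasurable (fun x => ‖g x‖ₑ ^ 2) (volume.restrict ω) := hg.1.enorm.pow_const 2
  -- The finite measure `|g|² dx` is inner regular, so cutting `g` off outside a compact subset of
  -- `ω` costs little in `L²`.
  set ν := (volume.restrict ω).withDensity fun x => ‖g x‖ₑ ^ 2
  have hν : IsFiniteMeasure ν := by
    refine isFiniteMeasure_withDensity ?_
    rw [← eLpNorm_two_sq]
    exact ENNReal.pow_ne_top hg.2.ne
  obtain ⟨K, hKω, hK, hKν⟩ := hω.measurableSet.exists_isCompact_sdiff_lt (μ := ν)
    (measure_ne_top ν ω) (pow_ne_zero 2 hη2)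
  set f := K.indicator g
  have hf : MemLp f 2 volume := by
    rw [memLp_indicator_iff_restrict hK.measurableSet]
    exact hg.mono_measure (Measure.restrict_mono hKω le_rfl)
  have hgf : eLpNorm (g - f) 2 (volume.restrict ω) ≤ η / 2 := by
    refine (ENNReal.pow_le_pow_left_iff two_ne_zero).1 ?_
    rw [eLpNorm_two_sq]
    have hm : MeasurableSet (ω \ K) := hω.measurableSet.diff hK.measurableSet
    rw [withDensity_apply _ hm] at hKν
    refine le_trans (le_of_eq ?_) hKν.le
    rw [← lintegral_indicator hm]
    refine setLIntegral_congr_fun hω.measurableSet fun x hx => ?_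
    by_cases hxK : x ∈ K <;> simp [f, hx, hxK]
  obtain ⟨r, hr, hmol⟩ := exists_eLpNorm_mollify_sub_le hf hη2
  obtain ⟨δ, hδ, hδω⟩ := hK.exists_cthickening_subset_open hω hKω
  have hm : 0 < min r δ := lt_min hr hδ
  -- The radius is at most `δ`, to keep the support in `ω`, and at most `r`, for the `L²` estimate.
  let φ : ContDiffBump (0 : Plane n) := ⟨min r δ / 2, min r δ, by positivity, by linarith⟩
  have hφr : φ.rOut = min r δ := rfl
  have hsub : Function.support (φ.normed volume ⋆[ContinuousLinearMap.lsmul ℝ ℝ, volume] f) ⊆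
      Metric.cthickening δ K := by
    refine (support_convolution_subset _).trans ?_
    rintro _ ⟨z, hz, y, hy, rfl⟩
    rw [φ.support_normed_eq, mem_ball_zero_iff, hφr] at hz
    have hyK : y ∈ K := by
      by_contra h
      exact hy (indicator_of_notMem h _)
    refine Metric.mem_cthickening_of_dist_le _ y δ K hyK ?_
    simp only [dist_eq_norm, add_sub_cancel_right]
    exact hz.le.trans (min_le_right _ _)
  have hts : tsupport (φ.normed volume ⋆[ContinuousLinearMap.lsmul ℝ ℝ, volume] f) ⊆
      Metric.cthickening δ K := closure_minimal hsub Metric.isClosed_cthickening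
  refine ⟨φ.normed volume ⋆[ContinuousLinearMap.lsmul ℝ ℝ, volume] f, ?_, ?_, hts.trans hδω, ?_⟩
  · exact φ.hasCompactSupport_normed.contDiff_convolution_left _ φ.contDiff_normed
      (hf.locallyIntegrable one_le_two)
  · exact hK.cthickening.of_isClosed_subset (isClosed_tsupport _) hts
  · have h1 := hmol 0 (by simpa using hr.le) φ (min_le_left _ _)
    simp only [add_zero] at h1
    have hc : Continuous (φ.normed volume ⋆[ContinuousLinearMap.lsmul ℝ ℝ, volume] f) :=
      (φ.hasCompactSupport_normed.contDiff_convolution_left (n := 0) _ φ.contDiff_normed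
        (hf.locallyIntegrable one_le_two)).continuous
    set m := φ.normed volume ⋆[ContinuousLinearMap.lsmul ℝ ℝ, volume] f
    have h2 : g - m = (g - f) - (m - f) := by abel
    rw [h2]
    refine (eLpNorm_sub_le (hg.1.sub hf.1.restrict)
      (hc.aestronglyMeasurable.sub hf.1.restrict) one_le_two).trans ?_
    calc _ ≤ η / 2 + η / 2 :=
          add_le_add hgf ((eLpNorm_mono_measure _ Measure.restrict_le_self).trans h1)
      _ = η := ENNReal.add_halves η

/-! ### The `Γ`-liminf inequality -/

/-- The constant `∫∫_{(0,1) × I} |t - τ|^{1-2s}`. -/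
def heightWeight (s : ℝ) (I : Set ℝ) : ℝ≥0∞ :=
  ∫⁻ t in Ioo (0 : ℝ) 1, ∫⁻ τ in I, ENNReal.ofReal (|t - τ| ^ (1 - 2 * s))

theorem heightWeight_Ioo {s : ℝ} (hs : s < 1) :
    heightWeight s (Ioo 0 1) = ENNReal.ofReal (1 / ((1 - s) * (3 - 2 * s))) := by
  rw [heightWeight, lintegral_abs_sub_rpow (by linarith)]
  congr 1
  have h1 : 1 - s ≠ 0 := by linarith
  have h2 : 3 - 2 * s ≠ 0 := by linarith
  have h3 : 1 - 2 * s + 1 ≠ 0 := by intro h; apply h1; linarith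
  have h4 : 1 - 2 * s + 2 ≠ 0 := by intro h; apply h2; linarith
  field_simp
  ring

theorem heightWeight_ne_top {s : ℝ} (hs : s < 1) {I : Set ℝ} (hI : I ⊆ Ioo 0 1) :
    heightWeight s I ≠ ∞ := by
  refine ne_top_of_le_ne_top (heightWeight_Ioo hs ▸ ENNReal.ofReal_ne_top) ?_
  exact lintegral_mono fun t => lintegral_mono_set hI

/-- An exhaustion of `(0, 1)` by compact intervals. -/
def heightIcc (m : ℕ) : Set ℝ := Icc (1 / ((m : ℝ) + 2)) (1 - 1 / ((m : ℝ) + 2))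

theorem heightIcc_subset (m : ℕ) : heightIcc m ⊆ Ioo 0 1 := fun t ht => by
  have : 0 < 1 / ((m : ℝ) + 2) := by positivity
  exact ⟨this.trans_le ht.1, ht.2.trans_lt (by linarith)⟩

theorem iUnion_heightIcc : ⋃ m, heightIcc m = Ioo 0 1 := by
  refine Subset.antisymm (iUnion_subset heightIcc_subset) fun t ht => ?_
  obtain ⟨m, hm⟩ := exists_nat_one_div_lt (lt_min ht.1 (sub_pos.2 ht.2))
  have h1 : 1 / ((m : ℝ) + 2) ≤ 1 / ((m : ℝ) + 1) := by gcongr; norm_num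
  have h2 := lt_min_iff.1 hm
  exact mem_iUnion.2 ⟨m, by linarith, by linarith⟩

/-- Monotone convergence in `τ`. The heights `τ` are kept in compact intervals because local
convergence says nothing near `0` and `1`; the heights `t` need no restriction, having disappeared
from the symmetric quotients. -/
theorem heightWeight_eq_iSup (s : ℝ) :
    heightWeight s (Ioo 0 1) = ⨆ m, heightWeight s (heightIcc m) := by
  have hsw : ∀ I : Set ℝ, heightWeight s I =
      ∫⁻ τ in I, ∫⁻ t in Ioo (0 : ℝ) 1, ENNReal.ofReal (|t - τ| ^ (1 - 2 * s)) := fun I =>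
    lintegral_lintegral_swap (by unfold Function.uncurry; fun_prop)
  simp_rw [hsw]
  rw [← iUnion_heightIcc, setLIntegral_iUnion_of_directed]
  refine Monotone.directed_le fun m k hmk => Icc_subset_Icc ?_ ?_
  · gcongr
  · gcongr

/-- The factor `1/(3-2s)` of the constant, together with `1/(1-s)`, is the weight of the heights;
the rest is the kernel moment. -/
theorem gammaLimit_value_eq {n : ℕ} {s : ℝ} (hs : s < 1) {ω : Set (Plane n)}
    {g : Plane n → Plane n} (hg : MemLp g 2 (volume.restrict ω)) :
    ENNReal.ofReal (1 / (1 - s) * Kconst n s * ∫ x in ω, ‖g x‖ ^ 2) =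
      heightWeight s (Ioo 0 1) *
        (ENNReal.ofReal (kernMoment n s) * ∫⁻ x in ω, ENNReal.ofReal (‖g x‖ ^ 2)) := by
  have h1 : 0 < 1 - s := by linarith
  have h2 : 0 < 3 - 2 * s := by linarith
  rw [heightWeight_Ioo hs, ← ofReal_integral_eq_lintegral_ofReal (hg.integrable_norm_pow two_ne_zero)
    (Eventually.of_forall fun x => by positivity), ← ENNReal.ofReal_mul (kernMoment_nonneg n s),
    ← ENNReal.ofReal_mul (by positivity), Kconst_eq]
  congr 1
  field_simp

/-- The lower bound for measurable functions, with heights restricted to a compact interval. -/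
theorem heightWeight_mul_le_liminf {n : ℕ} (hn : 1 ≤ n) {ω : Set (Plane n)} (hω : IsOpen ω)
    {u : Plane n → ℝ} (hum : Measurable u) {g : Plane n → Plane n} (hu : MemH1With ω u g)
    {w : ℕ → Plane n × ℝ → ℝ} (hw : ∀ j, Measurable (w j))
    {e : ℕ → ℝ} (he : ∀ j, 0 < e j) (he0 : Tendsto e atTop (𝓝 0))
    {s : ℕ → ℝ} {s₀ : ℝ} (hs₀ : s₀ ∈ Ioo (1 / 2) 1) (hs : Tendsto s atTop (𝓝 s₀))
    (hconv : DRConvergesL1Loc ω e w u) (m : ℕ) :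
    heightWeight s₀ (heightIcc m) *
      (ENNReal.ofReal (kernMoment n s₀) * ∫⁻ x in ω, ENNReal.ofReal (‖g x‖ ^ 2)) ≤
    liminf (fun j => scaledEnergy ω (s j) (e j) (w j)) atTop := by
  -- Arguing by contradiction fixes a subsequence with energies below `b`. Further subsequences,
  -- needed for convergence of almost every slice and possibly depending on `Φ`, then remain below
  -- `b`.
  by_contra! hlt
  obtain ⟨b, hb1, hb2⟩ := exists_between hlt
  obtain ⟨φ, hφ, hφb⟩ := extraction_of_frequently_atTop (frequently_lt_of_liminf_lt (h := hb1))
  set C := heightWeight s₀ (heightIcc m) * ENNReal.ofReal (kernMoment n s₀)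
  have hC : C ≠ ∞ := ENNReal.mul_ne_top (heightWeight_ne_top hs₀.2 (heightIcc_subset m))
    ENNReal.ofReal_ne_top
  have hall : ∀ k : ℕ, heightWeight s₀ (heightIcc m) *
      (ENNReal.ofReal (kernMoment n s₀) * ∫⁻ x in ω, ENNReal.ofReal (‖g x‖ ^ 2)) ≤
      b + C * (((k : ℝ≥0∞) + 1)⁻¹) ^ 2 := by
    intro k
    obtain ⟨Φ, hΦ, hsupp, hsub, hle⟩ := exists_contDiff_eLpNorm_sub_le hω hu.2.1
      (η := ((k : ℝ≥0∞) + 1)⁻¹) (by simp)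
    obtain ⟨δ, hδ, hK⟩ := hsupp.isCompact.exists_cthickening_subset_open hω hsub
    set K := Metric.cthickening δ (tsupport Φ)
    have hKc : IsCompact K := hsupp.isCompact.cthickening
    have huK : IntegrableOn u K := by
      have := hKc.measure_lt_top (μ := (volume : Measure (Plane n)))
      have hfin : IsFiniteMeasure (volume.restrict K) := ⟨by simpa using this⟩
      exact (hu.1.mono_measure (Measure.restrict_mono hK le_rfl)).integrable one_le_two
    set G : ℕ → ℝ → ℝ≥0∞ := fun j τ => ∫⁻ x in K, ‖w j (x, e j * τ) - u x‖ₑ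
    have hmeas : ∀ j, Measurable fun p : Plane n × ℝ => ‖w j (p.1, e j * p.2) - u p.1‖ₑ :=
      fun j => by have := hw j; fun_prop
    have hG : ∀ j, Measurable (G j) := fun j => (hmeas j).lintegral_prod_left'
    have hcv := hconv (K ×ˢ heightIcc m) (hKc.prod isCompact_Icc)
      (prod_mono hK (heightIcc_subset m))
    have hGt : Tendsto (fun j => ∫⁻ τ in heightIcc m, G (φ j) τ) atTop (𝓝 0) := by
      refine (hcv.comp hφ.tendsto_atTop).congr fun j => ?_
      simp only [Function.comp_apply]
      rw [Measure.volume_eq_prod, setLIntegral_prod_symm _ (hmeas _).aemeasurable]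
    obtain ⟨ψ, hψ, hae⟩ := exists_subseq_ae_tendsto_zero (fun j => hG (φ j)) hGt
    have hsub' := (hφ.comp hψ).tendsto_atTop
    have hmain := le_liminf_scaledEnergy_add hn hω hu.2.2 hu.2.1 hΦ hsupp hδ hK huK
      (w := fun j => w (φ (ψ j))) (fun j => hw _) (e := fun j => e (φ (ψ j))) (fun j => he _)
      (he0.comp hsub') hs₀.1 (s := fun j => s (φ (ψ j))) (hs.comp hsub') (heightIcc_subset m) hae
    refine hmain.trans (add_le_add ?_ ?_)
    · refine liminf_le_of_frequently_le' (Eventually.frequently (Eventually.of_forall fun j => ?_))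
      exact (hφb (ψ j)).le
    · rw [← mul_assoc]
      refine mul_le_mul' le_rfl ?_
      calc _ = eLpNorm (g - Φ) 2 (volume.restrict ω) ^ 2 := by
            rw [eLpNorm_two_sq]
            refine lintegral_congr fun x => ?_
            rw [ENNReal.ofReal_pow (norm_nonneg _), ofReal_norm]
        _ ≤ _ := by gcongr
  have hlim : Tendsto (fun k : ℕ => b + C * (((k : ℝ≥0∞) + 1)⁻¹) ^ 2) atTop (𝓝 (b + C * 0 ^ 2)) := by
    have h1 : Tendsto (fun k : ℕ => ((k : ℝ≥0∞) + 1)⁻¹) atTop (𝓝 0) := by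
      have := (tendsto_add_atTop_iff_nat 1).2 ENNReal.tendsto_inv_nat_nhds_zero
      simpa using this
    exact tendsto_const_nhds.add (ENNReal.Tendsto.const_mul (ENNReal.Tendsto.pow h1) (Or.inr hC))
  have := ge_of_tendsto' hlim hall
  simp only [ne_eq, OfNat.ofNat_ne_zero, not_false_eq_true, zero_pow, mul_zero, add_zero] at this
  exact absurd hb2 (not_lt.2 this)

theorem gagliardoSq_congr {n : ℕ} {A : Set (Plane n × ℝ)} (s : ℝ)
    {w w' : Plane n × ℝ → ℝ} (h : w =ᵐ[volume.restrict A] w') :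
    gagliardoSq s A w = gagliardoSq s A w' := by
  unfold gagliardoSq
  refine lintegral_congr_ae ?_
  rw [Measure.volume_eq_prod, ← Measure.prod_restrict]
  filter_upwards [Measure.quasiMeasurePreserving_fst.ae h,
    Measure.quasiMeasurePreserving_snd.ae h] with p h1 h2
  rw [h1, h2]

theorem scaledEnergy_congr {n : ℕ} {ω : Set (Plane n)} (s ε : ℝ)
    {w w' : Plane n × ℝ → ℝ} (h : w =ᵐ[volume.restrict (film ω ε)] w') :
    scaledEnergy ω s ε w = scaledEnergy ω s ε w' := by
  rw [scaledEnergy, scaledEnergy, gagliardoSq_congr s h]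

theorem quasiMeasurePreserving_scale_height {n : ℕ} (ω : Set (Plane n)) {ε : ℝ} (hε : 0 < ε) :
    Measure.QuasiMeasurePreserving (fun x : Plane n × ℝ => (x.1, ε * x.2))
      (volume.restrict (film ω 1)) (volume.restrict (film ω ε)) := by
  have h1 : Measure.QuasiMeasurePreserving (fun x : Plane n × ℝ => (x.1, ε * x.2))
      volume volume := by
    refine ⟨by fun_prop, ?_⟩
    have h2 := Measure.map_prod_map (volume : Measure (Plane n)) (volume : Measure ℝ)
      measurable_id (measurable_const_mul ε)
    rw [Measure.map_id, Real.map_volume_mul_left hε.ne'] at h2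
    rw [Measure.volume_eq_prod]
    refine (h2.symm.absolutelyContinuous).trans ?_
    exact Measure.AbsolutelyContinuous.rfl.prod Measure.smul_absolutelyContinuous
  refine h1.restrict fun x hx => ?_
  simpa only [film, mem_prod, mem_Ioo, mul_pos_iff_of_pos_left hε,
      mul_lt_iff_lt_one_right hε] using hx

theorem ae_restrict_fst {n : ℕ} {ω : Set (Plane n)} {p : Plane n → Prop}
    (h : ∀ᵐ x ∂volume.restrict ω, p x) : ∀ᵐ x ∂volume.restrict (film ω 1), p x.1 := by
  rw [film, Measure.volume_eq_prod, ← Measure.prod_restrict]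
  exact Measure.quasiMeasurePreserving_fst.ae h

/-- This permits measurable representatives: rescaling the height pulls null sets of the film back
to null sets of `ω × (0, 1)`. -/
theorem DRConvergesL1Loc.congr {n : ℕ} {ω : Set (Plane n)} {e : ℕ → ℝ}
    (he : ∀ j, 0 < e j) {w w' : ℕ → Plane n × ℝ → ℝ}
    (hw : ∀ j, w j =ᵐ[volume.restrict (film ω (e j))] w' j) {u u' : Plane n → ℝ}
    (hu : u =ᵐ[volume.restrict ω] u') (h : DRConvergesL1Loc ω e w u) :
    DRConvergesL1Loc ω e w' u' := by
  intro K hK hKω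
  refine (h K hK hKω).congr fun j => ?_
  refine lintegral_congr_ae (ae_mono (Measure.restrict_mono hKω le_rfl) ?_)
  filter_upwards [(quasiMeasurePreserving_scale_height ω (he j)).ae (hw j),
    ae_restrict_fst hu] with x h1 h2
  rw [h1, h2]

theorem IsWeakGradient.congr {n : ℕ} {ω : Set (Plane n)} {u u' : Plane n → ℝ}
    {g : Plane n → Plane n} (hu : u =ᵐ[volume.restrict ω] u') (h : IsWeakGradient ω u g) :
    IsWeakGradient ω u' g := by
  intro φ h1 h2 h3 v
  rw [← h φ h1 h2 h3 v]
  refine integral_congr_ae ?_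
  filter_upwards [hu] with x hx
  rw [hx]

theorem MemH1With.congr {n : ℕ} {ω : Set (Plane n)} {u u' : Plane n → ℝ}
    {g : Plane n → Plane n} (hu : u =ᵐ[volume.restrict ω] u') (h : MemH1With ω u g) :
    MemH1With ω u' g :=
  ⟨h.1.ae_eq hu, h.2.1, h.2.2.congr hu⟩

/-- The `Γ`-liminf inequality. -/
theorem gammaLiminf_inequality {n : ℕ} (hn : 1 ≤ n) {ω : Set (Plane n)} (hω : IsOpen ω)
    {u : Plane n → ℝ} {g : Plane n → Plane n} (hu : MemH1With ω u g)
    {e : ℕ → ℝ} (he : ∀ j, 0 < e j) (he0 : Tendsto e atTop (𝓝 0))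
    {w : ℕ → Plane n × ℝ → ℝ} (hw : ∀ j, LocallyIntegrableOn (w j) (film ω (e j)))
    {s : ℕ → ℝ} {s₀ : ℝ} (hs₀ : s₀ ∈ Ioo (1 / 2) 1) (hs : Tendsto s atTop (𝓝 s₀))
    (hconv : DRConvergesL1Loc ω e w u) :
    ENNReal.ofReal (1 / (1 - s₀) * Kconst n s₀ * ∫ x in ω, ‖g x‖ ^ 2) ≤
      liminf (fun j => scaledEnergy ω (s j) (e j) (w j)) atTop := by
  have hwm : ∀ j, AEMeasurable (w j) (volume.restrict (film ω (e j))) := fun j =>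
    (hw j).aestronglyMeasurable.aemeasurable
  have hum : AEMeasurable u (volume.restrict ω) := hu.1.aestronglyMeasurable.aemeasurable
  have hconv' := hconv.congr he (fun j => (hwm j).ae_eq_mk) hum.ae_eq_mk
  rw [gammaLimit_value_eq hs₀.2 hu.2.1, heightWeight_eq_iSup, ENNReal.iSup_mul]
  refine iSup_le fun m => ?_
  simp_rw [fun j => scaledEnergy_congr (s j) (e j) (hwm j).ae_eq_mk]
  exact heightWeight_mul_le_liminf hn hω hum.measurable_mk (hu.congr hum.ae_eq_mk)
    (fun j => (hwm j).measurable_mk) he he0 hs₀ hs hconv' m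

/-! ### The energy of `C¹` functions of the planar variable -/

theorem inner_gradient_eq {n : ℕ} (φ : Plane n → ℝ) (x ξ : Plane n) :
    inner ℝ (gradient φ x) ξ = fderiv ℝ φ x ξ := by
  rw [gradient, InnerProductSpace.toDual_symm_apply]

theorem continuous_gradient {n : ℕ} {φ : Plane n → ℝ} (hφ : ContDiff ℝ 1 φ) :
    Continuous (gradient φ) :=
  (InnerProductSpace.toDual ℝ (Plane n)).symm.continuous.comp (hφ.continuous_fderiv one_ne_zero)

theorem tendsto_diffQuot {n : ℕ} {φ : Plane n → ℝ} (hφ : Differentiable ℝ φ) (ξ x : Plane n)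
    {h : ℕ → ℝ} (hpos : ∀ j, 0 < h j) (hlim : Tendsto h atTop (𝓝 0)) :
    Tendsto (fun j => (φ (x + h j • ξ) - φ x) / h j) atTop (𝓝 (fderiv ℝ φ x ξ)) := by
  have hd : HasDerivAt (fun t : ℝ => φ (x + t • ξ)) (fderiv ℝ φ x ξ) 0 := by
    have h1 : HasFDerivAt φ (fderiv ℝ φ x) (x + (0 : ℝ) • ξ) := by
      simpa using (hφ x).hasFDerivAt
    have h2 : HasDerivAt (fun t : ℝ => x + t • ξ) ξ 0 := by
      simpa using ((hasDerivAt_id (0 : ℝ)).smul_const ξ).const_add x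
    exact h1.comp_hasDerivAt (0 : ℝ) h2
  have l1 : Tendsto h atTop (𝓝[≠] 0) := tendsto_nhdsWithin_iff.2
    ⟨hlim, Eventually.of_forall fun j => (hpos j).ne'⟩
  refine (hd.tendsto_slope_zero.comp l1).congr fun j => ?_
  simp only [Function.comp_apply, smul_eq_mul, zero_add, zero_smul, add_zero]
  rw [div_eq_inv_mul]

theorem abs_diffQuot_le {n : ℕ} {φ : Plane n → ℝ} {C : NNReal} (hC : LipschitzWith C φ) {h : ℝ}
    (hh : 0 < h) (ξ x : Plane n) : |(φ (x + h • ξ) - φ x) / h| ≤ C * ‖ξ‖ := by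
  have h1 := hC.dist_le_mul (x + h • ξ) x
  rw [dist_eq_norm (x + h • ξ), add_sub_cancel_left, norm_smul, Real.norm_of_nonneg hh.le,
    Real.dist_eq] at h1
  rw [abs_div, abs_of_pos hh, div_le_iff₀ hh]
  linarith

theorem blowup_self_height {n : ℕ} {s : ℝ} (hs : 1 / 2 < s) (ε : ℝ) (w : Plane n × ℝ → ℝ)
    (t : ℝ) (ξ x : Plane n) : blowup s ε w t t ξ x = 0 := by
  rw [blowup, sub_self, abs_zero, Real.zero_rpow (by linarith)]
  simp

/-- A majorant uniform in `s ∈ [s₁, s₂]`: since `|t - τ| ≤ 1` the weight grows with `s`, while the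
kernel decreases with `s`. For `s₁ > 1/2` the kernel factor has finite integral, for `s₂ < 1` the
weight does. -/
theorem blowup_le_of_lipschitz {n : ℕ} {φ : Plane n → ℝ} {C : NNReal} (hC : LipschitzWith C φ)
    {s s₁ s₂ ε : ℝ} (hε : 0 < ε) (hs₁ : 1 / 2 < s₁) (hs : s ∈ Icc s₁ s₂) {t τ : ℝ}
    (ht : t ∈ Ioo (0 : ℝ) 1) (hτ : τ ∈ Ioo (0 : ℝ) 1) (ξ x : Plane n) :
    blowup s ε (fun z => φ z.1) t τ ξ x ≤ ENNReal.ofReal (|t - τ| ^ (1 - 2 * s₂)) *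
      (ENNReal.ofReal (kern n s₁ ξ * ‖ξ‖ ^ 2) * ENNReal.ofReal (C ^ 2)) := by
  rcases eq_or_ne t τ with rfl | htτ
  · rw [blowup_self_height (hs₁.trans_le hs.1)]; exact zero_le
  have hd : 0 < |t - τ| := abs_pos.2 (sub_ne_zero.2 htτ)
  have hd1 : |t - τ| ≤ 1 := abs_le.2 ⟨by linarith [ht.1, hτ.2], by linarith [ht.2, hτ.1]⟩
  have hk := (kern_pos n s₁ ξ).le
  have hk' := (kern_pos n s ξ).le
  rw [← ENNReal.ofReal_mul (by positivity), ← ENNReal.ofReal_mul (by positivity), blowup]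
  refine ENNReal.ofReal_le_ofReal ?_
  have h1 : |t - τ| ^ (1 - 2 * s) ≤ |t - τ| ^ (1 - 2 * s₂) :=
    Real.rpow_le_rpow_of_exponent_ge hd hd1 (by linarith [hs.2])
  have h2 := kern_anti n hs.1 ξ
  have h3 := sq_le_sq.2 ((abs_diffQuot_le hC (mul_pos hε hd) ξ x).trans (le_abs_self _))
  calc _ ≤ |t - τ| ^ (1 - 2 * s₂) * kern n s₁ ξ * (C * ‖ξ‖) ^ 2 := by
        simp only
        gcongr
    _ = _ := by ring

theorem tendsto_blowup {n : ℕ} {φ : Plane n → ℝ} (hφ : Differentiable ℝ φ)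
    {e : ℕ → ℝ} (he : ∀ j, 0 < e j) (he0 : Tendsto e atTop (𝓝 0))
    {s : ℕ → ℝ} {s₀ : ℝ} (hs₀ : 1 / 2 < s₀) (hs : Tendsto s atTop (𝓝 s₀)) (t τ : ℝ)
    (ξ x : Plane n) :
    Tendsto (fun j => blowup (s j) (e j) (fun z => φ z.1) t τ ξ x) atTop
      (𝓝 (ENNReal.ofReal (|t - τ| ^ (1 - 2 * s₀)) *
        (ENNReal.ofReal (kern n s₀ ξ) * ENNReal.ofReal (inner ℝ (gradient φ x) ξ ^ 2)))) := by
  have hk := (kern_pos n s₀ ξ).le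
  rw [← ENNReal.ofReal_mul hk, ← ENNReal.ofReal_mul (by positivity), inner_gradient_eq, ← mul_assoc]
  rcases eq_or_ne t τ with rfl | htτ
  · have : ∀ᶠ j in atTop, 0 = blowup (s j) (e j) (fun z => φ z.1) t t ξ x := by
      filter_upwards [hs.eventually_const_lt hs₀] with j hj
      rw [blowup_self_height hj]
    refine Tendsto.congr' this ?_
    simp [Real.zero_rpow (by linarith : 1 - 2 * s₀ ≠ 0)]
  · have hd : 0 < |t - τ| := abs_pos.2 (sub_ne_zero.2 htτ)
    have h1 : (0 : ℝ) < 1 + ‖ξ‖ ^ 2 := by positivity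
    refine (ENNReal.continuous_ofReal.tendsto _).comp (Tendsto.mul (Tendsto.mul ?_ ?_) ?_)
    · exact tendsto_const_nhds.rpow ((hs.const_mul 2).const_sub 1) (Or.inl hd.ne')
    · unfold kern
      exact (tendsto_const_nhds.rpow (hs.const_add _) (Or.inl h1.ne')).inv₀ (by positivity)
    · exact (tendsto_diffQuot hφ ξ x (fun j => mul_pos (he j) hd)
        (by simpa using he0.mul_const |t - τ|)).pow 2

/-- The energy of a `C¹` function of the planar variable alone. -/
theorem limsup_scaledEnergy_le {n : ℕ} (hn : 1 ≤ n) {ω : Set (Plane n)} (hω : IsOpen ω)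
    (hωb : Bornology.IsBounded ω) {φ : Plane n → ℝ} (hφ : ContDiff ℝ 1 φ)
    (hsupp : HasCompactSupport φ)
    {e : ℕ → ℝ} (he : ∀ j, 0 < e j) (he0 : Tendsto e atTop (𝓝 0))
    {s : ℕ → ℝ} {s₀ : ℝ} (hs₀ : s₀ ∈ Ioo (1 / 2) 1) (hs : Tendsto s atTop (𝓝 s₀)) :
    limsup (fun j => scaledEnergy ω (s j) (e j) fun z => φ z.1) atTop ≤
      heightWeight s₀ (Ioo 0 1) *
        (ENNReal.ofReal (kernMoment n s₀) * ∫⁻ x in ω, ENNReal.ofReal (‖gradient φ x‖ ^ 2)) := by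
  obtain ⟨C, hC⟩ := hφ.lipschitzWith_of_hasCompactSupport hsupp one_ne_zero
  have hw : Measurable fun z : Plane n × ℝ => φ z.1 := hφ.continuous.measurable.comp measurable_fst
  obtain ⟨s₁, hs₁, hs₁'⟩ := exists_between hs₀.1
  obtain ⟨s₂, hs₂, hs₂'⟩ := exists_between hs₀.2
  set ν : Measure (ℝ × ℝ) := (volume.restrict (Ioo (0 : ℝ) 1)).prod (volume.restrict (Ioo (0 : ℝ) 1))
  set κ : Measure (Plane n × Plane n) := (volume : Measure (Plane n)).prod (volume.restrict ω)
  set Q : ℕ → (ℝ × ℝ) × (Plane n × Plane n) → ℝ≥0∞ := fun j p =>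
    blowup (s j) (e j) (fun z => φ z.1) p.1.1 p.1.2 p.2.1 p.2.2
  have hQ : ∀ j, Measurable (Q j) := fun j => measurable_blowup (s j) (e j) hw
  -- Enlarging the set of admissible `x` to all of `ω` makes the domain independent of `j`; it is
  -- harmless because `φ` is defined on the whole space.
  have hle : ∀ j, scaledEnergy ω (s j) (e j) (fun z => φ z.1) ≤ ∫⁻ p, Q j p ∂ν.prod κ := by
    intro j
    rw [scaledEnergy_eq_blowup hω.measurableSet (he j) hw, lintegral_prod _ (hQ j).aemeasurable,
      lintegral_prod _ (hQ j).lintegral_prod_right'.aemeasurable]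
    refine lintegral_mono fun t => lintegral_mono fun τ => ?_
    rw [lintegral_prod (fun q => Q j ((t, τ), q))
      ((hQ j).comp measurable_prodMk_left).aemeasurable]
    exact lintegral_mono fun ξ => lintegral_mono_set fun x hx => hx.1
  have hweight : ∀ r, ∫⁻ p, ENNReal.ofReal (|p.1 - p.2| ^ (1 - 2 * r)) ∂ν =
      heightWeight r (Ioo 0 1) := fun r => lintegral_prod _ (by fun_prop)
  have hvol : volume.restrict ω univ ≠ ∞ := by
    rw [Measure.restrict_apply_univ]; exact hωb.measure_lt_top.ne
  have hgrad : Measurable (gradient φ) := (continuous_gradient hφ).measurable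
  have hlim : Tendsto (fun j => ∫⁻ p, Q j p ∂ν.prod κ) atTop
      (𝓝 (∫⁻ p, ENNReal.ofReal (|p.1.1 - p.1.2| ^ (1 - 2 * s₀)) * (ENNReal.ofReal (kern n s₀ p.2.1) *
        ENNReal.ofReal (inner ℝ (gradient φ p.2.2) p.2.1 ^ 2)) ∂ν.prod κ)) := by
    refine tendsto_lintegral_filter_of_dominated_convergence
      (fun p => ENNReal.ofReal (|p.1.1 - p.1.2| ^ (1 - 2 * s₂)) *
        (ENNReal.ofReal (kern n s₁ p.2.1 * ‖p.2.1‖ ^ 2) * ENNReal.ofReal (C ^ 2)))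
      (Eventually.of_forall hQ) ?_ ?_ ?_
    · have hν : ∀ᵐ q ∂ν, q ∈ Ioo (0 : ℝ) 1 ×ˢ Ioo (0 : ℝ) 1 := by
        simp only [ν, Measure.prod_restrict]
        exact ae_restrict_mem (measurableSet_Ioo.prod measurableSet_Ioo)
      filter_upwards [hs.eventually_const_le hs₁', hs.eventually_le_const hs₂] with j h1 h2
      filter_upwards [Measure.quasiMeasurePreserving_fst.ae hν] with p hp
      exact blowup_le_of_lipschitz hC (he j) hs₁ ⟨h1, h2⟩ hp.1 hp.2 _ _
    · rw [lintegral_prod_mul (μ := ν) (ν := κ)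
        (f := fun q => ENNReal.ofReal (|q.1 - q.2| ^ (1 - 2 * s₂)))
        (g := fun q => ENNReal.ofReal (kern n s₁ q.1 * ‖q.1‖ ^ 2) * ENNReal.ofReal (C ^ 2))
        (by fun_prop) (by fun_prop), hweight]
      refine ENNReal.mul_ne_top (heightWeight_ne_top hs₂' Subset.rfl) ?_
      rw [lintegral_prod_mul (f := fun ξ : Plane n => ENNReal.ofReal (kern n s₁ ξ * ‖ξ‖ ^ 2))
        (g := fun _ => ENNReal.ofReal (C ^ 2)) (by fun_prop) (by fun_prop), lintegral_const]
      refine ENNReal.mul_ne_top ?_ (ENNReal.mul_ne_top ENNReal.ofReal_ne_top hvol)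
      rw [← ofReal_integral_eq_lintegral_ofReal (integrable_kern_mul_norm_sq n hs₁)
        (Eventually.of_forall fun ξ => mul_nonneg (kern_pos n s₁ ξ).le (by positivity))]
      exact ENNReal.ofReal_ne_top
    · exact Eventually.of_forall fun p =>
        tendsto_blowup (hφ.differentiable one_ne_zero) he he0 hs₀.1 hs _ _ _ _
  refine (limsup_le_limsup (Eventually.of_forall hle)).trans (le_of_eq ?_)
  rw [hlim.limsup_eq, lintegral_prod_mul (μ := ν) (ν := κ)
    (f := fun q => ENNReal.ofReal (|q.1 - q.2| ^ (1 - 2 * s₀)))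
    (g := fun q => ENNReal.ofReal (kern n s₀ q.1) *
      ENNReal.ofReal (inner ℝ (gradient φ q.2) q.1 ^ 2)) (by fun_prop) (by fun_prop), hweight,
    lintegral_prod _ (by fun_prop),
    ← lintegral_kern_mul_lintegral_inner_sq hn hs₀.1 hgrad.aemeasurable]
  congr 2 with ξ
  exact lintegral_const_mul' (ENNReal.ofReal (kern n s₀ ξ))
    (fun y => ENNReal.ofReal (inner ℝ (gradient φ y) ξ ^ 2)) ENNReal.ofReal_ne_top

/-! ### Density of `C¹` functions in `H¹` of a Lipschitz set -/

/-- `(u, g)` can be approximated in `L²(ω)` by compactly supported `C¹` functions of the whole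
space together with their gradients. -/
def H1Approx {n : ℕ} (ω : Set (Plane n)) (u : Plane n → ℝ) (g : Plane n → Plane n) : Prop :=
  ∀ η : ℝ≥0∞, η ≠ 0 → ∃ φ : Plane n → ℝ, ContDiff ℝ 1 φ ∧ HasCompactSupport φ ∧
    eLpNorm (u - φ) 2 (volume.restrict ω) ≤ η ∧
    eLpNorm (g - gradient φ) 2 (volume.restrict ω) ≤ η

theorem H1Approx.congr {n : ℕ} {ω : Set (Plane n)} {u u' : Plane n → ℝ} {g g' : Plane n → Plane n}
    (h : H1Approx ω u g) (hu : u =ᵐ[volume.restrict ω] u') (hg : g =ᵐ[volume.restrict ω] g') :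
    H1Approx ω u' g' := by
  intro η hη
  obtain ⟨φ, h1, h2, h3, h4⟩ := h η hη
  refine ⟨φ, h1, h2, ?_, ?_⟩
  · rwa [← eLpNorm_congr_ae (hu.sub (ae_eq_refl φ))]
  · rwa [← eLpNorm_congr_ae (hg.sub (ae_eq_refl (gradient φ)))]

theorem H1Approx.zero {n : ℕ} (ω : Set (Plane n)) : H1Approx ω 0 0 := by
  intro η _
  refine ⟨0, contDiff_const, HasCompactSupport.zero, by simp, ?_⟩
  have : gradient (0 : Plane n → ℝ) = 0 := by
    ext1 x; exact gradient_const x 0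
  simp [this]

theorem gradient_add {n : ℕ} {φ ψ : Plane n → ℝ} (hφ : Differentiable ℝ φ)
    (hψ : Differentiable ℝ ψ) : gradient (φ + ψ) = gradient φ + gradient ψ := by
  ext1 x
  simp only [gradient, fderiv_add (hφ x) (hψ x), map_add, Pi.add_apply]

theorem H1Approx.add {n : ℕ} {ω : Set (Plane n)} {u u' : Plane n → ℝ} {g g' : Plane n → Plane n}
    (h : H1Approx ω u g) (h' : H1Approx ω u' g')
    (hu : AEStronglyMeasurable u (volume.restrict ω))
    (hu' : AEStronglyMeasurable u' (volume.restrict ω))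
    (hg : AEStronglyMeasurable g (volume.restrict ω))
    (hg' : AEStronglyMeasurable g' (volume.restrict ω)) : H1Approx ω (u + u') (g + g') := by
  intro η hη
  have hη2 : η / 2 ≠ 0 := by simp [hη]
  obtain ⟨φ, h1, h2, h3, h4⟩ := h _ hη2
  obtain ⟨ψ, h1', h2', h3', h4'⟩ := h' _ hη2
  refine ⟨φ + ψ, h1.add h1', h2.add h2', ?_, ?_⟩
  · rw [add_sub_add_comm, ← ENNReal.add_halves η]
    exact (eLpNorm_add_le (hu.sub h1.continuous.aestronglyMeasurable)
      (hu'.sub h1'.continuous.aestronglyMeasurable) one_le_two).trans (add_le_add h3 h3')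
  · rw [gradient_add (h1.differentiable one_ne_zero) (h1'.differentiable one_ne_zero),
      add_sub_add_comm, ← ENNReal.add_halves η]
    exact (eLpNorm_add_le (hg.sub (continuous_gradient h1).aestronglyMeasurable)
      (hg'.sub (continuous_gradient h1').aestronglyMeasurable) one_le_two).trans (add_le_add h4 h4')

theorem H1Approx.sum {n : ℕ} {ω : Set (Plane n)} {ι : Type*} (t : Finset ι) {u : ι → Plane n → ℝ}
    {g : ι → Plane n → Plane n} (h : ∀ i ∈ t, H1Approx ω (u i) (g i))
    (hu : ∀ i, AEStronglyMeasurable (u i) (volume.restrict ω))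
    (hg : ∀ i, AEStronglyMeasurable (g i) (volume.restrict ω)) :
    H1Approx ω (∑ i ∈ t, u i) (∑ i ∈ t, g i) := by
  classical
  induction t using Finset.induction_on with
  | empty => simpa using H1Approx.zero ω
  | insert i t hi ih =>
    rw [Finset.sum_insert hi, Finset.sum_insert hi]
    exact (h i (Finset.mem_insert_self i t)).add
      (ih fun k hk => h k (Finset.mem_insert_of_mem hk)) (hu i)
      (Finset.aestronglyMeasurable_sum t fun k _ => hu k) (hg i)
      (Finset.aestronglyMeasurable_sum t fun k _ => hg k)

/-- Arbitrarily small translations of `ω`, even after a smaller perturbation, stay inside `ω` as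
long as they stay inside `S`. -/
def PushesInside {n : ℕ} (ω S : Set (Plane n)) : Prop :=
  ∀ r : ℝ, 0 < r → ∃ a : Plane n, ‖a‖ ≤ r ∧ ∃ δ : ℝ, 0 < δ ∧ δ ≤ r ∧
    ∀ x ∈ ω, ∀ z : Plane n, ‖z‖ ≤ δ → x + a - z ∈ S → x + a - z ∈ ω

theorem pushesInside_of_subset {n : ℕ} {ω S : Set (Plane n)} (h : S ⊆ ω) : PushesInside ω S :=
  fun r hr => ⟨0, by simpa using hr.le, r, hr, le_rfl, fun _ _ _ _ hS => h hS⟩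

/-- Near a Lipschitz boundary point, translations in the vertical direction push `ω` inside. -/
theorem pushesInside_of_epigraph {n : ℕ} {ω : Set (Plane n)} {p ν : Plane n} {R : ℝ}
    (hν : ‖ν‖ = 1) {L : NNReal} {γ : Plane n → ℝ} (hγ : LipschitzWith L γ)
    (hω : ω ∩ Metric.ball p R =
      {x | γ (x - (inner ℝ ν x) • ν) < inner ℝ ν x} ∩ Metric.ball p R)
    {S : Set (Plane n)} (hS : IsCompact S) (hSR : S ⊆ Metric.ball p R) : PushesInside ω S := by
  intro r hr
  obtain ⟨δ₀, hδ₀, hδS⟩ := hS.exists_cthickening_subset_open Metric.isOpen_ball hSR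
  -- The original point differs from the shifted one by at most `2t ≤ δ₀`, so it too lies in the
  -- ball where the epigraph description holds.
  set t := min r (δ₀ / 2)
  have ht : 0 < t := lt_min hr (by positivity)
  have hL : (0 : ℝ) ≤ L := L.coe_nonneg
  have hδt : t / (1 + 2 * L) ≤ t := div_le_self ht.le (by linarith)
  -- A perturbation `z` lowers the height by at most `‖z‖` and moves the base point by at most
  -- `2‖z‖`, hence raises the graph by at most `2L‖z‖`; the total `(1 + 2L)‖z‖` must not exceed the
  -- upward shift `t`.
  refine ⟨t • ν, ?_, t / (1 + 2 * L), by positivity, hδt.trans (min_le_left _ _), ?_⟩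
  · rw [norm_smul, hν, mul_one, Real.norm_of_nonneg ht.le]
    exact min_le_left _ _
  intro x hx z hz hy
  set y := x + t • ν - z with hydef
  have hxy : x - y = z - t • ν := by rw [hydef]; abel
  have hxball : x ∈ Metric.ball p R := by
    refine hδS (Metric.mem_cthickening_of_dist_le x y δ₀ S hy ?_)
    rw [dist_eq_norm, hxy]
    have h1 : ‖t • ν‖ = t := by rw [norm_smul, hν, mul_one, Real.norm_of_nonneg ht.le]
    have h2 : t ≤ δ₀ / 2 := min_le_right _ _
    linarith [norm_sub_le z (t • ν)]
  have hxe : γ (x - (inner ℝ ν x) • ν) < inner ℝ ν x :=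
    ((hω ▸ (⟨hx, hxball⟩ : x ∈ ω ∩ Metric.ball p R) :
      x ∈ {x | γ (x - (inner ℝ ν x) • ν) < inner ℝ ν x} ∩ Metric.ball p R)).1
  have hνν : inner ℝ ν ν = 1 := by rw [real_inner_self_eq_norm_sq, hν]; norm_num
  have hin : inner ℝ ν y = inner ℝ ν x + t - inner ℝ ν z := by
    rw [hydef, inner_sub_right, inner_add_right, inner_smul_right, hνν, mul_one]
  have hzν : |inner ℝ ν z| ≤ ‖z‖ := by
    have := abs_real_inner_le_norm ν z
    rwa [hν, one_mul] at this
  have hlip := hγ.dist_le_mul (y - (inner ℝ ν y) • ν) (x - (inner ℝ ν x) • ν)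
  have hdist : dist (y - (inner ℝ ν y) • ν) (x - (inner ℝ ν x) • ν) ≤ 2 * ‖z‖ := by
    have e : y - (inner ℝ ν y) • ν - (x - (inner ℝ ν x) • ν) = inner ℝ ν z • ν - z := by
      rw [hin, hydef]; module
    rw [dist_eq_norm, e]
    have := norm_sub_le (inner ℝ ν z • ν) z
    rw [norm_smul, hν, mul_one, Real.norm_eq_abs] at this
    linarith
  have hye : γ (y - (inner ℝ ν y) • ν) < inner ℝ ν y := by
    rw [Real.dist_eq] at hlip
    have h1 := (abs_le.1 hlip).2
    have h2 : L * dist (y - (inner ℝ ν y) • ν) (x - (inner ℝ ν x) • ν) ≤ L * (2 * ‖z‖) := by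
      gcongr
    have h3 : ‖z‖ * (1 + 2 * L) ≤ t := by rwa [← le_div_iff₀ (by positivity)]
    have h4 := (abs_le.1 hzν).2
    have h5 := hin.ge
    nlinarith
  exact ((hω.symm ▸ (⟨hye, hSR hy⟩ : y ∈ {x | γ (x - (inner ℝ ν x) • ν) < inner ℝ ν x} ∩
    Metric.ball p R) : y ∈ ω ∩ Metric.ball p R)).1

theorem HasLipschitzBoundary.exists_pushesInside {n : ℕ} {ω : Set (Plane n)} (hω : IsOpen ω)
    (h : HasLipschitzBoundary ω) {p : Plane n} (hp : p ∈ closure ω) :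
    ∃ R > 0, ∀ S : Set (Plane n), IsCompact S → S ⊆ Metric.ball p R → PushesInside ω S := by
  by_cases hpω : p ∈ ω
  · obtain ⟨R, hR, hball⟩ := Metric.isOpen_iff.1 hω p hpω
    exact ⟨R, hR, fun S _ hS => pushesInside_of_subset (hS.trans hball)⟩
  · have hpf : p ∈ frontier ω := by rw [hω.frontier_eq]; exact ⟨hp, hpω⟩
    obtain ⟨R, hR, ν, hν, L, γ, hγ, he⟩ := h p hpf
    exact ⟨R, hR, fun S hS hSR => pushesInside_of_epigraph hν hγ he hS hSR⟩

/-- The Leibniz rule for weak gradients, tested against functions whose support meets that of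
`χ` inside `ω`. -/
theorem MemH1With.integral_mul_fderiv {n : ℕ} {ω : Set (Plane n)} {u : Plane n → ℝ}
    {g : Plane n → Plane n} (hu : MemH1With ω u g) {χ θ : Plane n → ℝ}
    (hχ : ContDiff ℝ (⊤ : ℕ∞) χ) (hχs : HasCompactSupport χ)
    (hθ : ContDiff ℝ (⊤ : ℕ∞) θ) (hθs : HasCompactSupport θ)
    (hsub : tsupport χ ∩ tsupport θ ⊆ ω) (v : Plane n) :
    ∫ x in ω, χ x * u x * fderiv ℝ θ x v =
      - ∫ x in ω, inner ℝ (χ x • g x + u x • gradient χ x) v * θ x := by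
  have hχθ : ContDiff ℝ (⊤ : ℕ∞) (χ * θ) := hχ.mul hθ
  have hts : tsupport (χ * θ) ⊆ tsupport χ ∩ tsupport θ :=
    subset_inter (tsupport_mul_subset_left) (tsupport_mul_subset_right)
  have hweak := hu.2.2 (χ * θ) hχθ (hχs.mul_right) (hts.trans hsub) v
  have hχ1 : Differentiable ℝ χ := hχ.differentiable (by simp)
  have hθ1 : Differentiable ℝ θ := hθ.differentiable (by simp)
  have hfd : ∀ x, fderiv ℝ (χ * θ) x v = χ x * fderiv ℝ θ x v + θ x * fderiv ℝ χ x v := by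
    intro x
    rw [fderiv_mul (hχ1 x) (hθ1 x)]
    simp
  have cχ' : Continuous fun x => fderiv ℝ χ x v :=
    (hχ.continuous_fderiv (by simp)).clm_apply continuous_const
  have cθ' : Continuous fun x => fderiv ℝ θ x v :=
    (hθ.continuous_fderiv (by simp)).clm_apply continuous_const
  have m1 : MemLp (fun x => χ x * fderiv ℝ θ x v) 2 (volume.restrict ω) :=
    ((hχ.continuous.mul cθ').memLp_of_hasCompactSupport hχs.mul_right).restrict ω
  have m2 : MemLp (fun x => θ x * fderiv ℝ χ x v) 2 (volume.restrict ω) :=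
    ((hθ.continuous.mul cχ').memLp_of_hasCompactSupport hθs.mul_right).restrict ω
  have m3 : MemLp (fun x => χ x * θ x) 2 (volume.restrict ω) :=
    ((hχ.continuous.mul hθ.continuous).memLp_of_hasCompactSupport hχs.mul_right).restrict ω
  have i1 : Integrable (fun x => u x * (χ x * fderiv ℝ θ x v)) (volume.restrict ω) :=
    hu.1.integrable_mul m1
  have i2 : Integrable (fun x => u x * (θ x * fderiv ℝ χ x v)) (volume.restrict ω) :=
    hu.1.integrable_mul m2
  have i3 : Integrable (fun x => inner ℝ (g x) v * (χ x * θ x)) (volume.restrict ω) :=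
    (memLp_inner_const hu.2.1 v).integrable_mul m3
  have e1 : ∫ x in ω, u x * fderiv ℝ (χ * θ) x v =
      (∫ x in ω, u x * (χ x * fderiv ℝ θ x v)) + ∫ x in ω, u x * (θ x * fderiv ℝ χ x v) := by
    rw [← integral_add i1 i2]
    congr 1 with x
    rw [hfd]; ring
  have e2 : ∫ x in ω, inner ℝ (χ x • g x + u x • gradient χ x) v * θ x =
      (∫ x in ω, inner ℝ (g x) v * (χ x * θ x)) + ∫ x in ω, u x * (θ x * fderiv ℝ χ x v) := by
    rw [← integral_add i3 i2]
    congr 1 with x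
    rw [inner_add_left, real_inner_smul_left, real_inner_smul_left, inner_gradient_eq]; ring
  have e3 : ∫ x in ω, χ x * u x * fderiv ℝ θ x v = ∫ x in ω, u x * (χ x * fderiv ℝ θ x v) := by
    congr 1 with x; ring
  rw [e1] at hweak
  rw [e2, e3]
  simp only [Pi.mul_apply] at hweak
  linarith

/-- Differentiating the mollifier in `y` is minus differentiating `x ↦ ρ (y - x)`; in this form the
weak gradient can be tested against `x ↦ ρ (y - x)`. -/
theorem fderiv_convolution_apply {n : ℕ} {ρ f : Plane n → ℝ} (hρ : ContDiff ℝ 1 ρ)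
    (hρs : HasCompactSupport ρ) (hf : LocallyIntegrable f) (y v : Plane n) :
    fderiv ℝ (ρ ⋆[ContinuousLinearMap.lsmul ℝ ℝ, volume] f) y v =
      - ∫ x, f x * fderiv ℝ (fun x => ρ (y - x)) x v := by
  have h1 := hρs.hasFDerivAt_convolution_left (ContinuousLinearMap.lsmul ℝ ℝ) hρ hf y
  rw [h1.fderiv, convolution_eq_swap, ContinuousLinearMap.integral_apply, ← integral_neg]
  · congr 1 with x
    have h2 : fderiv ℝ (fun x => ρ (y - x)) x = -fderiv ℝ ρ (y - x) := by
      have h3 : HasFDerivAt (fun x => y - x) (-ContinuousLinearMap.id ℝ (Plane n)) x :=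
        (hasFDerivAt_id x).const_sub y
      have h4 := ((hρ.differentiable one_ne_zero) (y - x)).hasFDerivAt.comp x h3
      refine (HasFDerivAt.fderiv h4 : fderiv ℝ (fun x => ρ (y - x)) x = _).trans ?_
      ext; simp
    rw [h2]
    simp [mul_comm]
  · have := (hρs.fderiv ℝ).convolutionExists_left
      (ContinuousLinearMap.precompL (Plane n) (ContinuousLinearMap.lsmul ℝ ℝ))
      (hρ.continuous_fderiv one_ne_zero) hf y
    exact this.integrable_swap

/-- Localisation, translation and mollification: approximation of `χ u`. -/
theorem MemH1With.h1Approx_mul {n : ℕ} {ω : Set (Plane n)} (hω : IsOpen ω) {u : Plane n → ℝ}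
    {g : Plane n → Plane n} (hu : MemH1With ω u g) {χ : Plane n → ℝ}
    (hχ : ContDiff ℝ (⊤ : ℕ∞) χ) (hχs : HasCompactSupport χ)
    (hpush : PushesInside ω (tsupport χ)) :
    H1Approx ω (fun x => χ x * u x) (fun x => χ x • g x + u x • gradient χ x) := by
  intro η hη
  have hχ1 : ContDiff ℝ 1 χ := hχ.of_le (by simp)
  have hgχs : HasCompactSupport (gradient χ) :=
    (hχs.fderiv ℝ).comp_left (g := (InnerProductSpace.toDual ℝ (Plane n)).symm) (map_zero _)
  have mu : MemLp (fun x => χ x * u x) 2 (volume.restrict ω) :=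
    hu.1.mul ((hχ.continuous.memLp_of_hasCompactSupport (p := ∞) hχs).restrict ω)
  have mG : MemLp (fun x => χ x • g x + u x • gradient χ x) 2 (volume.restrict ω) :=
    (hu.2.1.smul ((hχ.continuous.memLp_of_hasCompactSupport (p := ∞) hχs).restrict ω)).add
      (((continuous_gradient hχ1).memLp_of_hasCompactSupport (p := ∞) hgχs).restrict ω |>.smul hu.1)
  set v := ω.indicator fun x => χ x * u x with hv
  set G := ω.indicator fun x => χ x • g x + u x • gradient χ x with hG
  have hvL : MemLp v 2 volume := (memLp_indicator_iff_restrict hω.measurableSet).2 mu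
  have hGL : MemLp G 2 volume := (memLp_indicator_iff_restrict hω.measurableSet).2 mG
  have hvl : LocallyIntegrable v volume := hvL.locallyIntegrable one_le_two
  have hGl : LocallyIntegrable G volume := hGL.locallyIntegrable one_le_two
  have hvs : HasCompactSupport v := by
    refine hχs.mono fun x hx => ?_
    rw [Function.mem_support] at hx ⊢
    intro h0
    refine hx ?_
    by_cases hxω : x ∈ ω <;> simp [v, hxω, h0]
  obtain ⟨r₁, hr₁, hmol₁⟩ := exists_eLpNorm_mollify_sub_le hvL hη
  obtain ⟨r₂, hr₂, hmol₂⟩ := exists_eLpNorm_mollify_sub_le hGL hη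
  obtain ⟨a, har, δ, hδ, hδr, hin⟩ := hpush (min r₁ r₂) (lt_min hr₁ hr₂)
  let B : ContDiffBump (0 : Plane n) := ⟨δ / 2, δ, by positivity, by linarith⟩
  have hB : B.rOut = δ := rfl
  set ρ := B.normed (volume : Measure (Plane n))
  have hρ : ContDiff ℝ (⊤ : ℕ∞) ρ := B.contDiff_normed
  have hρs : HasCompactSupport ρ := B.hasCompactSupport_normed
  set m := ρ ⋆[ContinuousLinearMap.lsmul ℝ ℝ, volume] v
  have hm : ContDiff ℝ 1 m := hρs.contDiff_convolution_left (n := 1) _ (hρ.of_le (by simp)) hvl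
  have hadd : ContDiff ℝ 1 fun x : Plane n => x + a := contDiff_id.add contDiff_const
  -- Only points of `ω` matter. For these, `hin` keeps the part of the mollifier's support around `x
  -- + a` that meets the support of `χ` inside `ω`, so the zero extension of `χ u` produces no
  -- boundary term.
  have hgrad : ∀ x ∈ ω, gradient (fun x => m (x + a)) x =
      (ρ ⋆[ContinuousLinearMap.lsmul ℝ ℝ, volume] G) (x + a) := by
    intro x hx
    refine ext_inner_right ℝ fun z => ?_
    have hθ : ContDiff ℝ (⊤ : ℕ∞) fun y => ρ (x + a - y) := hρ.comp (contDiff_const.sub contDiff_id)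
    have hθt : tsupport (fun y => ρ (x + a - y)) ⊆ Metric.closedBall (x + a) δ := by
      refine closure_minimal (fun y hy => ?_) Metric.isClosed_closedBall
      have : x + a - y ∈ Function.support ρ := hy
      rw [B.support_normed_eq, mem_ball_zero_iff, hB] at this
      rw [Metric.mem_closedBall, dist_comm, dist_eq_norm]
      exact this.le
    have hθs : HasCompactSupport fun y => ρ (x + a - y) :=
      (isCompact_closedBall (x + a) δ).of_isClosed_subset (isClosed_tsupport _) hθt
    have hsub : tsupport χ ∩ tsupport (fun y => ρ (x + a - y)) ⊆ ω := by
      rintro y ⟨hy1, hy2⟩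
      have h1 := hθt hy2
      rw [Metric.mem_closedBall, dist_comm, dist_eq_norm] at h1
      have h2 := hin x hx (x + a - y) h1
      rw [sub_sub_cancel] at h2
      exact h2 hy1
    have hibp := hu.integral_mul_fderiv hχ hχs hθ hθs hsub z
    have i1 : Integrable fun y => ρ (x + a - y) • G y :=
      (hρs.convolutionExists_left (ContinuousLinearMap.lsmul ℝ ℝ) hρ.continuous hGl
        (x + a)).integrable_swap
    rw [inner_gradient_eq, fderiv_comp_add_right,
      fderiv_convolution_apply (hρ.of_le (by simp)) hρs hvl, convolution_eq_swap]
    have e1 : ∫ y, v y * fderiv ℝ (fun y => ρ (x + a - y)) y z =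
        ∫ y in ω, χ y * u y * fderiv ℝ (fun y => ρ (x + a - y)) y z := by
      rw [← integral_indicator hω.measurableSet]
      congr 1 with y
      by_cases hy : y ∈ ω <;> simp [v, hy]
    have e2 : ∫ y, inner ℝ z (ρ (x + a - y) • G y) =
        ∫ y in ω, inner ℝ (χ y • g y + u y • gradient χ y) z * ρ (x + a - y) := by
      rw [← integral_indicator hω.measurableSet]
      congr 1 with y
      by_cases hy : y ∈ ω
      · rw [indicator_of_mem hy, hG, indicator_of_mem hy, inner_smul_right, real_inner_comm,
          mul_comm]
      · rw [indicator_of_notMem hy, hG, indicator_of_notMem hy, smul_zero, inner_zero_right]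
    simp only [ContinuousLinearMap.lsmul_apply]
    rw [e1, hibp, neg_neg, real_inner_comm, ← integral_inner i1, e2]
  refine ⟨fun x => m (x + a), hm.comp hadd, ?_, ?_, ?_⟩
  · exact (hρs.convolution _ hvs).comp_homeomorph (Homeomorph.addRight a)
  · have h1 := hmol₁ a (har.trans (min_le_left _ _)) B (hδr.trans (min_le_left _ _))
    refine le_trans ?_ ((eLpNorm_mono_measure _ (Measure.restrict_le_self (s := ω))).trans h1)
    rw [eLpNorm_sub_comm]
    refine (eLpNorm_congr_ae ?_).le
    filter_upwards [ae_restrict_mem hω.measurableSet] with x hx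
    simp only [Pi.sub_apply, hv, indicator_of_mem hx]
    rfl
  · have h1 := hmol₂ a (har.trans (min_le_right _ _)) B (hδr.trans (min_le_right _ _))
    refine le_trans ?_ ((eLpNorm_mono_measure _ (Measure.restrict_le_self (s := ω))).trans h1)
    rw [eLpNorm_sub_comm]
    refine (eLpNorm_congr_ae ?_).le
    filter_upwards [ae_restrict_mem hω.measurableSet] with x hx
    simp only [Pi.sub_apply, hG, indicator_of_mem hx]
    rw [hgrad x hx]

/-- On a bounded open set with Lipschitz boundary, restrictions of `C¹` functions are dense
in `H¹`. -/
theorem MemH1With.h1Approx {n : ℕ} {ω : Set (Plane n)} (hω : IsOpen ω)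
    (hωb : Bornology.IsBounded ω) (hωl : HasLipschitzBoundary ω) {u : Plane n → ℝ}
    {g : Plane n → Plane n} (hu : MemH1With ω u g) : H1Approx ω u g := by
  have hcl : IsCompact (closure ω) := hωb.isCompact_closure
  choose R hR hpush using fun p : closure ω => hωl.exists_pushesInside hω p.2
  obtain ⟨t, ht⟩ := hcl.elim_finite_subcover (fun p : closure ω => Metric.ball (p : Plane n) (R p))
    (fun p => Metric.isOpen_ball)
    fun x hx => mem_iUnion.2 ⟨⟨x, hx⟩, Metric.mem_ball_self (hR ⟨x, hx⟩)⟩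
  obtain ⟨f, hf⟩ := SmoothPartitionOfUnity.exists_isSubordinate 𝓘(ℝ, Plane n) isClosed_closure
    (fun p : t => Metric.ball ((p : closure ω) : Plane n) (R p)) (fun p => Metric.isOpen_ball)
    (by rwa [iUnion_subtype])
  have hsm : ∀ i, ContDiff ℝ (⊤ : ℕ∞) (f i) := fun i => (f i).contMDiff.contDiff
  have hcs : ∀ i, HasCompactSupport (f i) := fun i =>
    Metric.isCompact_of_isClosed_isBounded (isClosed_tsupport _)
      (Metric.isBounded_ball.subset (hf i))
  have hone : ∀ x ∈ ω, ∑ i, f i x = 1 := fun x hx => by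
    rw [← finsum_eq_sum_of_fintype]; exact f.sum_eq_one (subset_closure hx)
  -- The partition sums to the constant `1` on the open set `ω`, so the terms `u • gradient (f i)`
  -- cancel in the sum.
  have hgrad : ∀ x ∈ ω, ∑ i, gradient (f i) x = 0 := by
    intro x hx
    have h1 : HasFDerivAt (fun x => ∑ i, f i x) (∑ i, fderiv ℝ (f i) x) x :=
      HasFDerivAt.fun_sum fun i _ => ((hsm i).differentiable (by simp) x).hasFDerivAt
    have h2 : HasFDerivAt (fun x => ∑ i, f i x) (0 : Plane n →L[ℝ] ℝ) x := by
      refine (hasFDerivAt_const (1 : ℝ) x).congr_of_eventuallyEq ?_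
      filter_upwards [hω.mem_nhds hx] with y hy using hone y hy
    simp only [gradient, ← map_sum, h1.unique h2, map_zero]
  have happ : ∀ i, H1Approx ω (fun x => f i x * u x)
      (fun x => f i x • g x + u x • gradient (f i) x) := fun i =>
    hu.h1Approx_mul hω (hsm i) (hcs i) (hpush i _ (hcs i) (hf i))
  have hum := hu.1.aestronglyMeasurable
  have hgm := hu.2.1.aestronglyMeasurable
  have hsum := H1Approx.sum Finset.univ (fun i _ => happ i)
    (fun i => (hsm i).continuous.aestronglyMeasurable.mul hum)
    (fun i => ((hsm i).continuous.aestronglyMeasurable.smul hgm).add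
      (hum.smul (continuous_gradient ((hsm i).of_le (by simp))).aestronglyMeasurable))
  refine hsum.congr ?_ ?_
  · filter_upwards [ae_restrict_mem hω.measurableSet] with x hx
    rw [Finset.sum_apply, ← Finset.sum_mul, hone x hx, one_mul]
  · filter_upwards [ae_restrict_mem hω.measurableSet] with x hx
    rw [Finset.sum_apply, Finset.sum_add_distrib, ← Finset.sum_smul, ← Finset.smul_sum, hone x hx,
      hgrad x hx, one_smul, smul_zero, add_zero]

/-! ### The recovery sequence -/

/-- If property `k` holds from index `φ k` on, take `κ j` to be the largest `k ≤ j` with `φ k ≤ j`.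
The default value `0` of the search is legitimate once `j ≥ φ 0`. -/
theorem exists_diagonal {P : ℕ → ℕ → Prop} (h : ∀ k, ∀ᶠ j in atTop, P k j) :
    ∃ κ : ℕ → ℕ, Tendsto κ atTop atTop ∧ ∀ᶠ j in atTop, P (κ j) j := by
  obtain ⟨φ, hφ, hP⟩ := extraction_forall_of_eventually'
    (P := fun k N => ∀ j ≥ N, P k j) fun k => by
      obtain ⟨N, hN⟩ := eventually_atTop.1 (h k)
      exact ⟨N, fun M hM j hj => hN j (hM.trans hj)⟩
  refine ⟨fun j => Nat.findGreatest (fun k => φ k ≤ j) j, ?_, ?_⟩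
  · refine tendsto_atTop.2 fun b => ?_
    filter_upwards [eventually_ge_atTop (φ b), eventually_ge_atTop b] with j h1 h2
    exact Nat.le_findGreatest h2 h1
  · filter_upwards [eventually_ge_atTop (φ 0)] with j hj
    exact hP _ j (Nat.findGreatest_spec (P := fun k => φ k ≤ j) (Nat.zero_le j) hj)

theorem memHs_zero {n : ℕ} (s : ℝ) (A : Set (Plane n × ℝ)) : MemHs s A fun _ => 0 :=
  ⟨MemLp.zero', by simp [gagliardoSq]⟩

theorem volume_film_lt_top {n : ℕ} {ω : Set (Plane n)} (hωb : Bornology.IsBounded ω) (ε : ℝ) :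
    volume (film ω ε) < ∞ := by
  rw [film, Measure.volume_eq_prod, Measure.prod_prod]
  exact ENNReal.mul_lt_top hωb.measure_lt_top (by simp)

theorem memHs_of_scaledEnergy_lt_top {n : ℕ} {ω : Set (Plane n)} (hωb : Bornology.IsBounded ω)
    {φ : Plane n → ℝ} (hφ : Continuous φ) (hsupp : HasCompactSupport φ) {s ε : ℝ} (hε : 0 < ε)
    (h : scaledEnergy ω s ε (fun z => φ z.1) < ∞) : MemHs s (film ω ε) fun z => φ z.1 := by
  obtain ⟨C, hC⟩ := hφ.bounded_above_of_compact_support hsupp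
  have : IsFiniteMeasure (volume.restrict (film ω ε)) :=
    ⟨by simpa using volume_film_lt_top hωb ε⟩
  refine ⟨MemLp.of_bound (hφ.comp continuous_fst).aestronglyMeasurable C
    (Eventually.of_forall fun z => hC z.1), ?_⟩
  rw [scaledEnergy] at h
  refine ENNReal.lt_top_of_mul_ne_top_right h.ne ?_
  rw [ne_eq, ENNReal.ofReal_eq_zero, not_le]
  positivity

theorem lintegral_film_one {n : ℕ} {ω : Set (Plane n)} {f : Plane n → ℝ≥0∞}
    (hf : AEMeasurable f (volume.restrict ω)) :
    ∫⁻ x in film ω 1, f x.1 = ∫⁻ x in ω, f x := by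
  have := lintegral_prod_mul (ν := volume.restrict (Ioo (0 : ℝ) 1)) hf
    (aemeasurable_const (b := (1 : ℝ≥0∞)))
  rw [Measure.prod_restrict] at this
  simpa [film, Measure.volume_eq_prod] using this

/-- Existence of a recovery sequence. -/
theorem exists_recovery_sequence {n : ℕ} (hn : 1 ≤ n) {ω : Set (Plane n)} (hω : IsOpen ω)
    (hωb : Bornology.IsBounded ω) (hωl : HasLipschitzBoundary ω) {u : Plane n → ℝ}
    {g : Plane n → Plane n} (hu : MemH1With ω u g)
    {e : ℕ → ℝ} (he : ∀ j, 0 < e j) (he0 : Tendsto e atTop (𝓝 0))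
    {s : ℕ → ℝ} {s₀ : ℝ} (hs₀ : s₀ ∈ Ioo (1 / 2) 1) (hs : Tendsto s atTop (𝓝 s₀)) :
    ∃ w : ℕ → Plane n × ℝ → ℝ, (∀ j, MemHs (s j) (film ω (e j)) (w j)) ∧
      DRConvergesL1Loc ω e w u ∧
      limsup (fun j => scaledEnergy ω (s j) (e j) (w j)) atTop ≤
        ENNReal.ofReal (1 / (1 - s₀) * Kconst n s₀ * ∫ x in ω, ‖g x‖ ^ 2) := by
  classical
  have hsq : ∀ f : Plane n → Plane n, ∫⁻ x in ω, ENNReal.ofReal (‖f x‖ ^ 2) =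
      eLpNorm f 2 (volume.restrict ω) ^ 2 := fun f => by
    rw [eLpNorm_two_sq]
    exact lintegral_congr fun x => by rw [ENNReal.ofReal_pow (norm_nonneg _), ofReal_norm]
  set a : ℕ → ℝ≥0∞ := fun k => ((k : ℝ≥0∞) + 1)⁻¹
  have ha0 : ∀ k, a k ≠ 0 := fun k => by simp [a]
  have hat : ∀ k, a k ≠ ∞ := fun k => by simp [a]
  have halim : Tendsto a atTop (𝓝 0) := by
    have := (tendsto_add_atTop_iff_nat 1).2 ENNReal.tendsto_inv_nat_nhds_zero
    simpa [a] using this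
  choose φ hφ hφs hφu hφg using fun k => hu.h1Approx hω hωb hωl (a k) (ha0 k)
  set C := heightWeight s₀ (Ioo 0 1) * ENNReal.ofReal (kernMoment n s₀)
  have hC : C ≠ ∞ := ENNReal.mul_ne_top (heightWeight_ne_top hs₀.2 Subset.rfl)
    ENNReal.ofReal_ne_top
  set N := eLpNorm g 2 (volume.restrict ω)
  have hN : N ≠ ∞ := hu.2.1.2.ne
  -- The extra `a k` gives the strict inequality needed to pass from a limsup to all large indices.
  set B : ℕ → ℝ≥0∞ := fun k => C * (N + a k) ^ 2 + a k
  have hBt : ∀ k, B k < ∞ := fun k => ENNReal.add_lt_top.2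
    ⟨ENNReal.mul_lt_top hC.lt_top (ENNReal.pow_lt_top (ENNReal.add_lt_top.2
      ⟨hN.lt_top, (hat k).lt_top⟩)), (hat k).lt_top⟩
  have hBlim : Tendsto B atTop (𝓝 (C * N ^ 2)) := by
    have h1 : Tendsto (fun k => N + a k) atTop (𝓝 N) := by
      simpa using tendsto_const_nhds.add halim
    simpa using (ENNReal.Tendsto.const_mul (ENNReal.Tendsto.pow h1) (Or.inr hC)).add halim
  have hev : ∀ k, ∀ᶠ j in atTop, scaledEnergy ω (s j) (e j) (fun z => φ k z.1) < B k := by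
    intro k
    refine eventually_lt_of_limsup_lt ((limsup_scaledEnergy_le hn hω hωb (hφ k) (hφs k) he he0 hs₀
      hs).trans_lt ?_)
    rw [hsq, ← mul_assoc]
    have h1 : eLpNorm (gradient (φ k)) 2 (volume.restrict ω) ≤ N + a k := by
      have : gradient (φ k) = g - (g - gradient (φ k)) := by abel
      rw [this]
      have hm := (continuous_gradient (hφ k)).aestronglyMeasurable (μ := volume.restrict ω)
      exact (eLpNorm_sub_le hu.2.1.1 (hu.2.1.1.sub hm) one_le_two).trans
        (add_le_add le_rfl (hφg k))
    have h2 : C * (N + a k) ^ 2 ≠ ∞ :=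
      ENNReal.mul_ne_top hC (ENNReal.pow_ne_top (ENNReal.add_ne_top.2 ⟨hN, hat k⟩))
    calc _ ≤ C * (N + a k) ^ 2 := by gcongr
      _ < B k := ENNReal.lt_add_right h2 (ha0 k)
  obtain ⟨κ, hκ, hP⟩ := exists_diagonal hev
  -- Membership in `H^s` is required for every `j`, whereas the energy bound holds only eventually;
  -- the remaining indices receive the zero function.
  refine ⟨fun j => if scaledEnergy ω (s j) (e j) (fun z => φ (κ j) z.1) < B (κ j) then
    fun z => φ (κ j) z.1 else fun _ => 0, fun j => ?_, ?_, ?_⟩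
  · dsimp only
    split_ifs with h
    · exact memHs_of_scaledEnergy_lt_top hωb (hφ _).continuous (hφs _) (he j) (h.trans (hBt _))
    · exact memHs_zero _ _
  · intro K _ hKω
    have hfin : volume.restrict ω univ ≠ ∞ := by
      rw [Measure.restrict_apply_univ]; exact hωb.measure_lt_top.ne
    -- The Hölder constant for `L² ⊆ L¹` on the bounded set `ω`.
    set c := volume.restrict ω univ ^ (1 / (1 : ℝ≥0∞).toReal - 1 / (2 : ℝ≥0∞).toReal)
    have hc : c ≠ ∞ := ENNReal.rpow_ne_top_of_nonneg (by norm_num) hfin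
    have hbound : Tendsto (fun j => a (κ j) * c) atTop (𝓝 0) := by
      simpa using ENNReal.Tendsto.mul_const (halim.comp hκ) (Or.inr hc)
    refine tendsto_of_tendsto_of_tendsto_of_le_of_le' tendsto_const_nhds hbound
      (Eventually.of_forall fun j => zero_le) ?_
    filter_upwards [hP] with j hj
    rw [if_pos hj]
    have hm : AEStronglyMeasurable (u - φ (κ j)) (volume.restrict ω) :=
      hu.1.1.sub (hφ _).continuous.aestronglyMeasurable
    calc _ ≤ ∫⁻ x in film ω 1, ‖φ (κ j) x.1 - u x.1‖ₑ := lintegral_mono_set hKω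
      _ = ∫⁻ x in film ω 1, ‖(u - φ (κ j)) x.1‖ₑ :=
          lintegral_congr fun x => by rw [Pi.sub_apply, ← enorm_neg, neg_sub]
      _ = eLpNorm (u - φ (κ j)) 1 (volume.restrict ω) := by
          rw [lintegral_film_one (f := fun x => ‖(u - φ (κ j)) x‖ₑ) hm.enorm,
            eLpNorm_one_eq_lintegral_enorm]
      _ ≤ eLpNorm (u - φ (κ j)) 2 (volume.restrict ω) * c :=
          eLpNorm_le_eLpNorm_mul_rpow_measure_univ one_le_two hm
      _ ≤ a (κ j) * c := by gcongr; exact hφu _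
  · rw [gammaLimit_value_eq hs₀.2 hu.2.1, hsq, ← mul_assoc, ← (hBlim.comp hκ).limsup_eq]
    refine limsup_le_limsup ?_
    filter_upwards [hP] with j hj
    rw [if_pos hj]
    exact hj.le

end ThinFilm

end

/-! ### The `Γ`-limit -/

theorem theorem4p3 (n : ℕ) (hn : 1 ≤ n) (ω : Set (ThinFilm.Plane n))
    (hω_open : IsOpen ω) (hω_conn : IsConnected ω) (hω_bdd : Bornology.IsBounded ω)
    (hω_lip : ThinFilm.HasLipschitzBoundary ω)
    (s : ℝ → ℝ) (hs : ∀ ε : ℝ, 0 < ε → s ε ∈ Ioo (0 : ℝ) 1)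
    (s₀ : ℝ) (hs₀ : s₀ ∈ Ioo (1 / 2 : ℝ) 1) (hs_lim : Tendsto s (𝓝[>] 0) (𝓝 s₀))
    (X : ℝ → Set (ThinFilm.Plane n × ℝ → ℝ))
    (hX_lower : ∀ ε : ℝ, 0 < ε → {w | ThinFilm.MemHs (s ε) (ThinFilm.film ω ε) w} ⊆ X ε)
    (hX_upper : ∀ ε : ℝ, 0 < ε → X ε ⊆ {w | LocallyIntegrableOn w (ThinFilm.film ω ε)})
    (u : ThinFilm.Plane n → ℝ) (g : ThinFilm.Plane n → ThinFilm.Plane n)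
    (hu : ThinFilm.MemH1With ω u g) :
    ThinFilm.IsDRGammaLimitAt ω X (fun ε w => ThinFilm.scaledEnergy ω (s ε) ε w) u
      (ENNReal.ofReal (1 / (1 - s₀) * ThinFilm.Kconst n s₀ * ∫ x in ω, ‖g x‖ ^ 2)) := by
  intro e he he0
  have hse : Tendsto (fun j => s (e j)) atTop (𝓝 s₀) :=
    hs_lim.comp (tendsto_nhdsWithin_iff.2 ⟨he0, Eventually.of_forall he⟩)
  refine ⟨fun w hw hconv => ?_, ?_⟩
  · exact ThinFilm.gammaLiminf_inequality hn hω_open hu he he0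
      (fun j => hX_upper (e j) (he j) (hw j)) hs₀ hse hconv
  · obtain ⟨w, hwH, hconv, hlim⟩ := ThinFilm.exists_recovery_sequence hn hω_open hω_bdd hω_lip hu
      he he0 hs₀ hse
    exact ⟨w, fun j => hX_lower (e j) (he j) (hwH j), hconv, hlim⟩
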